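/- Let $E$ be a finite-dimensional real inner product space, $G$ a finite-dimensional real normed space, and $K\subset G$ a regular cone, i.e. a closed convex cone with nonempty interior $\operatorname{int}K$ that contains no line. Let $K^*=\{s\in G^*:\langle s,z\rangle\ge 0\ \forall z\in K\}$. Let $h$ be a $\nu$-logarithmically homogeneous barrier for $K$: $h:\operatorname{int}K\to\mathbb R$ is convex and three times continuously differentiable, it is closed (its epigraph is closed in $G\times\mathbb R$), and for all $x\in\operatorname{int}K$, $u\in G$, $t>0$, $$|D^3h(x)[u,u,u]|\le 2\,D^2h(x)[u,u]^{3/2},\qquad 2Dh(x)[u]-D^2h(x)[u,u]\le\nu,\qquad h(tx)=h(x)-\nu\ln t .$$ Consider the problem $$\min_{x\in E} f(x)\quad\text{s.t. } g(x)=0,\ c(x)\in K,$$ with $f:E\to\mathbb R$, $g=(g_1,\dots,g_m):E\to\mathbb R^m$, $c:E\to G$. Put $C=\{x: c(x)\in K\}$ and $C^\circ=\{x: c(x)\in\operatorname{int}K\}$. Assume that * $f,g,c$ are continuous on $C$ and (Fréchet) differentiable at every point of $C^\circ$; * the feasible set $\{x: g(x)=0,\ c(x)\in K\}$ is closed; *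 (constant rank) for every $x\in C^\circ$ with $g(x)=0$, the rank of $\{\nabla g_i(y)\}_{i=1}^m$ is constant for $y$ in a neighbourhood of $x$; * $x^*$ is a local solution of the problem, and there are points $z^k\in C^\circ$ with $g(z^k)=0$ and $z^k\to x^*$. Then there exist sequences $x^k\in E$, $y^k\in\mathbb R^m$, $s^k\in K^*$ such that 1. $c(x^k)\in\operatorname{int}K$ and $g(x^k)=0$ for all $k$, and $x^k\to x^*$; 2. $\nabla f(x^k)+\sum_{i=1}^m y^k_i\nabla g_i(x^k)-Dc(x^k)^*s^k\to 0$ in $E^*$, where $Dc(x)^*s=s\circ Dc(x)$; 3. $\langle s^k,c(x^k)\rangle\to 0$. If in addition $f,g,c$ are twice differentiable at every point of $C^\circ$, then, for these same sequences, there exist $\theta_k,\delta_k\in(0,\infty)$ with $\theta_k\to0$, $\delta_k\to0$ such that for every $k$ and every $d\in E$ with $\langle\nabla g_i(x^k),d\rangle=0$ for $i=1,\dots,m$, $$D^2f(x^k)[d,d]+\sum_{i=1}^m y^k_i D^2g_i(x^k)[d,d]-\big\langle s^k,D^2c(x^k)[d,d]\big\rangle+\theta_k\,D^2h(c(x^k))\big[Dc(x^k)d,\,Dc(x^k)d\big]+\delta_k\langle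 d,d\rangle\ \ge 0 .$$ -/

import Mathlib

open Filter Topology

/-- A closed convex cone `K` (in Mathlib: a `ProperCone`, which contains `0`) is *regular* if it is
solid (nonempty interior) and pointed (contains no line). -/
structure IsRegularCone {G : Type*} [NormedAddCommGroup G] [NormedSpace ℝ G]
    (K : ProperCone ℝ G) : Prop where
  solid : (interior (K : Set G)).Nonempty
  pointed : ∀ z ∈ K, -z ∈ K → z = 0

/-- The second derivative `D²φ(x)[u, v]`. -/
noncomputable def secondDeriv {V W : Type*} [NormedAddCommGroup V] [NormedSpace ℝ V]
    [NormedAddCommGroup W] [NormedSpace ℝ W] (φ : V → W) (x u v : V) : W :=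
  fderiv ℝ (fderiv ℝ φ) x u v

/-- `h` is a `ν`-logarithmically homogeneous (self-concordant) barrier for the cone `K`.
The domain of `h` is the interior of `K`; the values of `h` outside the interior are irrelevant
(`h` is thought of as `+∞` there). -/
structure IsLogHomBarrier {G : Type*} [NormedAddCommGroup G] [NormedSpace ℝ G]
    (K : ProperCone ℝ G) (ν : ℝ) (h : G → ℝ) : Prop where
  contDiffOn : ContDiffOn ℝ 3 h (interior (K : Set G))
  convexOn : ConvexOn ℝ (interior (K : Set G)) h
  /-- As an extended-valued function, `h` is closed: its epigraph is closed. -/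
  closed : IsClosed {p : G × ℝ | p.1 ∈ interior (K : Set G) ∧ h p.1 ≤ p.2}
  /-- `|D³h(x)[u,u,u]| ≤ 2 D²h(x)[u,u]^{3/2}`: `h` is a standard self-concordant function. -/
  self_concordant : ∀ x ∈ interior (K : Set G), ∀ u : G,
    |iteratedFDeriv ℝ 3 h x (fun _ => u)| ≤ 2 * (secondDeriv h x u u) ^ (3 / 2 : ℝ)
  /-- `sup_u (2 Dh(x)[u] - D²h(x)[u,u]) ≤ ν`: the barrier parameter of `h` is at most `ν`. -/
  barrier_parameter : ∀ x ∈ interior (K : Set G), ∀ u : G,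
    2 * fderiv ℝ h x u - secondDeriv h x u u ≤ ν
  log_homogeneous : ∀ x ∈ interior (K : Set G), ∀ t : ℝ, 0 < t →
    h (t • x) = h x - ν * Real.log t

/-- The dual cone `K* = {s ∈ G* | ⟨s, z⟩ ≥ 0 for all z ∈ K}`. -/
def dualCone {G : Type*} [NormedAddCommGroup G] [NormedSpace ℝ G] (K : ProperCone ℝ G) :
    Set (StrongDual ℝ G) :=
  {s | ∀ z ∈ K, 0 ≤ s z}

section Problem

variable {E G : Type*} [NormedAddCommGroup E] [InnerProductSpace ℝ E]
  [NormedAddCommGroup G] [NormedSpace ℝ G] {m : ℕ}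

/-- The set `C = {x | c(x) ∈ K}`. -/
def conicSet (K : ProperCone ℝ G) (c : E → G) : Set E := {x | c x ∈ K}

/-- The set `C° = {x | c(x) ∈ int K}`. -/
def strictConicSet (K : ProperCone ℝ G) (c : E → G) : Set E :=
  {x | c x ∈ interior (K : Set G)}

/-- The feasible set `{x | g(x) = 0, c(x) ∈ K}`. -/
def feasibleSet (K : ProperCone ℝ G) (g : E → Fin m → ℝ) (c : E → G) : Set E :=
  {x | g x = 0 ∧ c x ∈ K}

/-- The strictly feasible set `{x | g(x) = 0, c(x) ∈ int K}`. -/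
def strictlyFeasibleSet (K : ProperCone ℝ G) (g : E → Fin m → ℝ) (c : E → G) : Set E :=
  {x | g x = 0 ∧ c x ∈ interior (K : Set G)}

/-- `x` is a local solution of `min f(x)` subject to `g(x) = 0`, `c(x) ∈ K`. -/
def IsLocalSolution (K : ProperCone ℝ G) (f : E → ℝ) (g : E → Fin m → ℝ) (c : E → G)
    (x : E) : Prop :=
  x ∈ feasibleSet K g c ∧ IsLocalMinOn f (feasibleSet K g c) x

/-- The rank of the family of gradients `(∇g_i(x))_{i = 1, …, m}` in the dual of `E`. -/
noncomputable def gradientRank (g : E → Fin m → ℝ) (x : E) : ℕ :=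
  Set.finrank ℝ (Set.range fun i : Fin m => fderiv ℝ (fun z => g z i) x)

/-- Constant rank constraint qualification: around each strictly feasible point, the rank of the
gradients of the equality constraints is constant. -/
def ConstantRankCQ (K : ProperCone ℝ G) (g : E → Fin m → ℝ) (c : E → G) : Prop :=
  ∀ x ∈ strictlyFeasibleSet K g c, ∀ᶠ y in 𝓝 x, gradientRank g y = gradientRank g x

/-- `∇f(x) + ∑ i, y_i ∇g_i(x) - ∑ j, s_j ∇c_j(x)`, as an element of the dual of `E`. -/
noncomputable def lagrangianGradient (f : E → ℝ) (g : E → Fin m → ℝ) (c : E → G)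
    (x : E) (y : Fin m → ℝ) (s : StrongDual ℝ G) : StrongDual ℝ E :=
  fderiv ℝ f x + ∑ i, y i • fderiv ℝ (fun z => g z i) x - s.comp (fderiv ℝ c x)

/-- The quadratic form at `d` of `∇²f(x) + ∑ i, y_i ∇²g_i(x) - ∑ j, s_j ∇²c_j(x)`. -/
noncomputable def lagrangianHessian (f : E → ℝ) (g : E → Fin m → ℝ) (c : E → G)
    (x : E) (y : Fin m → ℝ) (s : StrongDual ℝ G) (d : E) : ℝ :=
  secondDeriv f x d d + ∑ i, y i * secondDeriv (fun z => g z i) x d d - s (secondDeriv c x d d)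

/-- `φ` is differentiable at each point of `U`, and so is its derivative. -/
def TwiceDifferentiableAtPoints {W : Type*} [NormedAddCommGroup W] [NormedSpace ℝ W]
    (φ : E → W) (U : Set E) : Prop :=
  ∀ x ∈ U, DifferentiableAt ℝ φ x ∧ DifferentiableAt ℝ (fderiv ℝ φ) x

end Problem

/-! Each term of the sequences comes from a proximal barrier subproblem: minimise f + θ h∘c + ε‖x -
x*‖² over the strictly feasible points of a small closed ball around x*. Closedness of h makes the
relevant sublevel set compact, and for small θ the proximal term keeps the minimiser off the
boundary of the ball (`IsLogHomBarrier.exists_isLocalMinOn`), so it is a local minimiser under g = 0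
alone. With s = -θ Dh(c(x)), convexity and logarithmic homogeneity give s ∈ K* and ⟨s, c(x)⟩ = θν;
the Lagrangian gradient is the proximal residual -2ε(x - x*); and the second-order condition of the
subproblem is the desired inequality with δ = 2ε.

The hard point is Lagrange's rule: g is differentiable but not C¹, so the classical constant rank
theorem does not apply. It is enough that every kernel vector of Dg(x) is a limit direction of the
fibre {g = 0} (`eventually_exists_eq_zero_near_tangent`). Let r be the rank, and restrict g to r + 1
variables, one along the kernel vector and r transversal, giving γ. If γ had no zero on the far face
of a thin box, the Poincaré–Miranda theorem would show that z ↦ (|γ(z)|², Pγ(z)) covers an open set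
in dimension r + 1; but its derivative has rank at most r, so its image is null
(`exists_eq_zero_on_slice`).

Poincaré–Miranda itself rests on a zero theorem for maps equal to the identity far out, proved by an
analytic no-retraction argument: the volume swept by id + t k is polynomial in t and constant for
small t, yet would vanish at t = 1. -/

/-! ### Zeros of maps equal to the identity far out, by comparison of volumes -/

open MeasureTheory Metric Set in
theorem LipschitzWith.volume_image_eq_zero {ι : Type*} [Fintype ι] {f : (ι → ℝ) → (ι → ℝ)}
    {C : NNReal} (hf : LipschitzWith C f) {s : Set (ι → ℝ)} (hs : volume s = 0) :
    volume (f '' s) = 0 := by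
  have h := hf.hausdorffMeasure_image_le (Nat.cast_nonneg (Fintype.card ι)) s
  rw [hausdorffMeasure_pi_real, hs, mul_zero] at h
  exact le_antisymm h bot_le

open Polynomial in
theorem LinearMap.exists_polynomial_eval_eq_det_id_add_smul {V : Type*} [AddCommGroup V]
    [Module ℝ V] [FiniteDimensional ℝ V] (A : V →ₗ[ℝ] V) :
    ∃ p : ℝ[X], p.natDegree ≤ Module.finrank ℝ V ∧
      ∀ t : ℝ, p.eval t = LinearMap.det (LinearMap.id + t • A) := by
  classical
  let b := Module.finBasis ℝ V
  let M := LinearMap.toMatrix b b A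
  refine ⟨Matrix.det ((X : ℝ[X]) • M.map C + (1 : Matrix _ _ ℝ).map C), ?_, fun t => ?_⟩
  · simpa using natDegree_det_X_add_C_le M 1
  · rw [eval_det, ← LinearMap.det_toMatrix b]
    congr 1
    ext i j
    simp [M, add_comm, mul_comm]

open MeasureTheory Metric Set in
/-- A small multiple of a compactly supported Lipschitz perturbation of the identity preserves
the (signed) volume of the ball. -/
theorem LipschitzWith.setIntegral_det_id_add_smul {ι : Type*} [Fintype ι]
    {k : (ι → ℝ) → (ι → ℝ)} {C : NNReal} (hk : LipschitzWith C k) {R : ℝ}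
    (hR : ∀ x, R ≤ ‖x‖ → k x = 0) {t : ℝ} (ht0 : 0 ≤ t) (ht : t * C < 1) :
    ∫ x in ball 0 R ∩ {x | DifferentiableAt ℝ k x},
      (ContinuousLinearMap.id ℝ (ι → ℝ) + t • fderiv ℝ k x).det = volume.real (ball (0 : ι → ℝ) R) := by
  lift t to NNReal using ht0
  set s := ball (0 : ι → ℝ) R ∩ {x | DifferentiableAt ℝ k x} with hs
  set F : (ι → ℝ) → (ι → ℝ) := fun x => x + (t : ℝ) • k x with hF
  have hsm : MeasurableSet s :=
    measurableSet_ball.inter (measurableSet_of_differentiableAt ℝ k)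
  have happ : ApproximatesLinearOn F
      ((ContinuousLinearEquiv.refl ℝ (ι → ℝ) : (ι → ℝ) ≃L[ℝ] (ι → ℝ)) : (ι → ℝ) →L[ℝ] (ι → ℝ))
      univ (t * C) := by
    intro x _ y _
    have := hk.dist_le_mul x y
    rw [dist_eq_norm, dist_eq_norm] at this
    simp only [hF, ContinuousLinearEquiv.coe_refl, ContinuousLinearMap.coe_id', id]
    have e : x + (t : ℝ) • k x - (y + (t : ℝ) • k y) - (x - y) = (t : ℝ) • (k x - k y) := by
      rw [smul_sub]; abel
    rw [e, norm_smul, Real.norm_of_nonneg t.coe_nonneg]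
    push_cast
    rw [mul_assoc]
    exact mul_le_mul_of_nonneg_left this t.coe_nonneg
  -- The perturbation criterion compares t * C with ‖id‖⁻¹, which is 1 only on a nontrivial space.
  have hc : Subsingleton (ι → ℝ) ∨ (t * C : NNReal) <
      ‖((ContinuousLinearEquiv.refl ℝ (ι → ℝ)).symm : (ι → ℝ) →L[ℝ] (ι → ℝ))‖₊⁻¹ := by
    rcases subsingleton_or_nontrivial (ι → ℝ) with h | h
    · exact Or.inl h
    · right
      have : ‖((ContinuousLinearEquiv.refl ℝ (ι → ℝ)).symm : (ι → ℝ) →L[ℝ] (ι → ℝ))‖₊ = 1 := by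
        ext; simp
      rw [this, inv_one, ← NNReal.coe_lt_coe]
      exact_mod_cast ht
  have hinj : Function.Injective F := injOn_univ.1 (happ.injOn hc)
  have hsurj : Function.Surjective F := happ.surjective hc
  have hFout : ∀ x, R ≤ ‖x‖ → F x = x := fun x hx => by simp [hF, hR x hx]
  -- F fixes every point outside the ball, so injectivity keeps the ball inside and surjectivity
  -- fills it.
  have himg : F '' ball 0 R = ball 0 R := by
    ext y
    constructor
    · rintro ⟨x, hx, rfl⟩
      by_contra hy
      simp only [mem_ball_zero_iff, not_lt] at hy hx
      have := hinj (hFout _ hy)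
      rw [this] at hy
      exact absurd hx (not_lt.2 hy)
    · intro hy
      obtain ⟨x, rfl⟩ := hsurj y
      refine ⟨x, ?_, rfl⟩
      by_contra hx
      simp only [mem_ball_zero_iff, not_lt] at hy hx
      rw [hFout x hx] at hy
      exact absurd hy (not_lt.2 hx)
  have hFlip : LipschitzWith (1 + t * C) F := by
    refine LipschitzWith.add LipschitzWith.id ?_
    refine LipschitzWith.of_dist_le_mul fun x y => ?_
    rw [dist_smul₀, Real.norm_of_nonneg t.coe_nonneg]
    push_cast
    rw [mul_assoc]
    exact mul_le_mul_of_nonneg_left (hk.dist_le_mul x y) t.coe_nonneg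
  -- Rademacher's theorem; the exceptional set has null image because F is Lipschitz.
  have hnull : volume (ball (0 : ι → ℝ) R \ s) = 0 := by
    refine measure_mono_null ?_ (ae_iff.1 hk.ae_differentiableAt)
    rintro x ⟨hx, hxs⟩
    exact fun h => hxs ⟨hx, h⟩
  have hvol : volume (F '' s) = volume (ball (0 : ι → ℝ) R) := by
    refine le_antisymm ((measure_mono (image_mono inter_subset_left)).trans_eq (by rw [himg])) ?_
    calc volume (ball (0 : ι → ℝ) R) = volume (F '' s ∪ F '' (ball 0 R \ s)) := by
          rw [← image_union, union_sdiff_cancel inter_subset_left, himg]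
      _ ≤ volume (F '' s) + volume (F '' (ball 0 R \ s)) := measure_union_le _ _
      _ = volume (F '' s) := by rw [hFlip.volume_image_eq_zero hnull, add_zero]
  have hderiv : ∀ x ∈ s, HasFDerivWithinAt F
      (ContinuousLinearMap.id ℝ (ι → ℝ) + (t : ℝ) • fderiv ℝ k x) s x := fun x hx =>
    ((hasFDerivAt_id x).add (hx.2.hasFDerivAt.const_smul t)).hasFDerivWithinAt
  have hcv := integral_image_eq_integral_abs_det_fderiv_smul volume hsm hderiv
    hinj.injOn (fun _ => (1 : ℝ))
  simp only [smul_eq_mul, mul_one, integral_const, MeasurableSet.univ, measureReal_restrict_apply,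
    univ_inter] at hcv
  rw [measureReal_def, hvol, ← measureReal_def] at hcv
  rw [hcv]
  refine setIntegral_congr_fun hsm fun x hx => ?_
  refine (abs_of_pos ?_).symm
  set A := fderiv ℝ k x with hA
  have hAn : ‖A‖ ≤ C := norm_fderiv_le_of_lipschitz ℝ hk
  -- Since u‖A‖ < 1, id + uA is injective along the whole path from u = 0, where the determinant is
  -- 1; hence it stays positive.
  have hne : ∀ u ∈ Icc 0 (t : ℝ), (ContinuousLinearMap.id ℝ (ι → ℝ) + u • A).det ≠ 0 := by
    intro u hu h0
    obtain ⟨v, hv, hv0⟩ := LinearMap.bot_lt_ker_of_det_eq_zero h0 |> SetLike.exists_of_lt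
    simp only [LinearMap.mem_ker, Submodule.mem_bot] at hv hv0
    have hv' : v = -(u • A v) := by
      have : v + u • A v = 0 := by simpa using hv
      exact eq_neg_of_add_eq_zero_left this
    have h1 : ‖v‖ ≤ u * C * ‖v‖ := by
      calc ‖v‖ = u * ‖A v‖ := by
            conv_lhs => rw [hv', norm_neg, norm_smul, Real.norm_of_nonneg hu.1]
        _ ≤ u * (C * ‖v‖) := mul_le_mul_of_nonneg_left
            (A.le_of_opNorm_le hAn v) hu.1
        _ = u * C * ‖v‖ := by ring
    have h2 : u * C < 1 := lt_of_le_of_lt (mul_le_mul_of_nonneg_right hu.2 C.2) ht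
    have h3 : 0 < ‖v‖ := norm_pos_iff.2 hv0
    nlinarith
  have hcont : Continuous fun u : ℝ => (ContinuousLinearMap.id ℝ (ι → ℝ) + u • A).det :=
    ContinuousLinearMap.continuous_det.comp (by fun_prop)
  by_contra hneg
  have hneg' := not_lt.1 hneg
  have h1 : (ContinuousLinearMap.id ℝ (ι → ℝ) + (0 : ℝ) • A).det = 1 := by
    simp [ContinuousLinearMap.det]
  obtain ⟨u, hu, hu0⟩ := intermediate_value_Icc' t.coe_nonneg hcont.continuousOn
    ⟨hneg', by rw [h1]; exact zero_le_one⟩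
  exact hne u hu hu0

-- The determinant of id + tA is a polynomial in t of degree at most the dimension. Interpolation
-- writes its value at t = 1 as a combination of values at other nodes with weights independent of
-- A, so it can be integrated term by term without handling the coefficients of the polynomial.
open Polynomial in
theorem LinearMap.det_id_add_eq_sum_lagrange {V : Type*} [AddCommGroup V] [Module ℝ V]
    [FiniteDimensional ℝ V] (A : V →ₗ[ℝ] V) {v : ℕ → ℝ} (hv : Function.Injective v) :
    LinearMap.det (LinearMap.id + A) = ∑ j ∈ Finset.range (Module.finrank ℝ V + 1),
      LinearMap.det (LinearMap.id + v j • A) *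
        (Lagrange.basis (Finset.range (Module.finrank ℝ V + 1)) v j).eval 1 := by
  obtain ⟨p, hp, hpe⟩ := A.exists_polynomial_eval_eq_det_id_add_smul
  have hdeg : p.degree < (Finset.range (Module.finrank ℝ V + 1)).card := by
    rw [Finset.card_range]
    exact degree_le_natDegree.trans_lt (by exact_mod_cast Nat.lt_succ_of_le hp)
  have h := congrArg (eval 1) (Lagrange.eq_interpolate (hv.injOn (s := _)) hdeg)
  rw [Lagrange.interpolate_apply, eval_finsetSum, hpe, one_smul] at h
  simpa [hpe] using h

theorem LipschitzWith.inv_norm_smul {X V : Type*} [PseudoMetricSpace X] [NormedAddCommGroup V]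
    [NormedSpace ℝ V] {F : X → V} {C : NNReal} (hF : LipschitzWith C F) {ε : ℝ} (hε : 0 < ε)
    (hFε : ∀ x, ε ≤ ‖F x‖) (x y : X) :
    ‖‖F x‖⁻¹ • F x - ‖F y‖⁻¹ • F y‖ ≤ 2 * C / ε * dist x y := by
  have hx : 0 < ‖F x‖ := hε.trans_le (hFε x)
  have hy : 0 < ‖F y‖ := hε.trans_le (hFε y)
  have hxy : ‖F x - F y‖ ≤ C * dist x y := by
    rw [← dist_eq_norm]; exact hF.dist_le_mul x y
  have e : ‖F x‖⁻¹ • F x - ‖F y‖⁻¹ • F y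
      = ‖F x‖⁻¹ • (F x - F y) + (‖F x‖⁻¹ - ‖F y‖⁻¹) • F y := by
    rw [smul_sub, sub_smul]; abel
  have h2 : ‖(‖F x‖⁻¹ - ‖F y‖⁻¹) • F y‖ ≤ ‖F x‖⁻¹ * ‖F x - F y‖ := by
    have e2 : (‖F x‖⁻¹ - ‖F y‖⁻¹) = ‖F x‖⁻¹ * ‖F y‖⁻¹ * (‖F y‖ - ‖F x‖) := by
      field_simp
    rw [norm_smul, e2, norm_mul, Real.norm_of_nonneg (by positivity), Real.norm_eq_abs]
    have := abs_norm_sub_norm_le (F y) (F x)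
    rw [norm_sub_rev] at this
    calc ‖F x‖⁻¹ * ‖F y‖⁻¹ * |‖F y‖ - ‖F x‖| * ‖F y‖
        = ‖F x‖⁻¹ * |‖F y‖ - ‖F x‖| := by field_simp
      _ ≤ _ := by gcongr
  calc _ ≤ ‖‖F x‖⁻¹ • (F x - F y)‖ + ‖(‖F x‖⁻¹ - ‖F y‖⁻¹) • F y‖ := by
        rw [e]; exact norm_add_le _ _
    _ ≤ ‖F x‖⁻¹ * ‖F x - F y‖ + ‖F x‖⁻¹ * ‖F x - F y‖ := by
        refine add_le_add ?_ h2
        rw [norm_smul, Real.norm_of_nonneg (by positivity)]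
    _ = 2 * (‖F x‖⁻¹ * ‖F x - F y‖) := by ring
    _ ≤ 2 * (ε⁻¹ * (C * dist x y)) := by
        gcongr
        exact hFε x
    _ = _ := by ring

/-- The derivative of a map into a sphere is singular. -/
theorem HasFDerivAt.det_eq_zero_of_norm_eq {V : Type*} [NormedAddCommGroup V] [NormedSpace ℝ V]
    [FiniteDimensional ℝ V] {G : V → V} {G' : V →L[ℝ] V} {x : V} (hG : HasFDerivAt G G' x)
    {R : ℝ} (hR : 0 < R) (hGR : ∀ᶠ y in 𝓝 x, ‖G y‖ = R) : G'.det = 0 := by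
  by_contra hdet
  have hGx : ‖G x‖ = R := hGR.self_of_nhds
  obtain ⟨l, hl, hlx⟩ := exists_dual_vector ℝ (G x) (by rw [hGx]; exact hR.ne')
  have hmax : IsLocalMax (fun y => l (G y)) x := by
    filter_upwards [hGR] with y hy
    calc l (G y) ≤ ‖l (G y)‖ := le_abs_self _
      _ ≤ 1 * ‖G y‖ := l.le_of_opNorm_le hl.le _
      _ = l (G x) := by rw [hlx, hy, one_mul]; simp [hGx]
  have h0 := hmax.hasFDerivAt_eq_zero (l.hasFDerivAt.comp x hG)
  have hsurj : Function.Surjective G' :=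
    (LinearMap.equivOfDetNeZero (G' : V →ₗ[ℝ] V) hdet).surjective
  obtain ⟨w, hw⟩ := hsurj (G x)
  have := congrArg (fun L : V →L[ℝ] ℝ => L w) h0
  simp only [ContinuousLinearMap.comp_apply, hw, hlx, zero_apply] at this
  simp [hGx] at this
  exact hR.ne' this

-- If F has no zero, its radial normalisation G sends the ball into the sphere of radius R and is
-- the identity outside. For k = G - id the integral of det(id + t Dk) equals the volume of the ball
-- at small t, hence by interpolation at t = 1, where the integrand is det DG = 0.
open MeasureTheory Metric Set in
theorem LipschitzWith.exists_eq_zero_of_eq_self {ι : Type*} [Fintype ι]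
    {F : (ι → ℝ) → (ι → ℝ)} {C : NNReal} (hF : LipschitzWith C F) {R : ℝ} (hR : 0 < R)
    (hFR : ∀ x, R ≤ ‖x‖ → F x = x) : ∃ x, F x = 0 := by
  by_contra! hne
  obtain ⟨ε, hε, hFε⟩ : ∃ ε > 0, ∀ x, ε ≤ ‖F x‖ := by
    obtain ⟨x₀, -, hx₀⟩ := (isCompact_closedBall (0 : ι → ℝ) R).exists_isMinOn
      ⟨0, by simp [hR.le]⟩ hF.continuous.norm.continuousOn
    refine ⟨min R ‖F x₀‖, lt_min hR (norm_pos_iff.2 (hne x₀)), fun x => ?_⟩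
    rcases le_total R ‖x‖ with h | h
    · rw [hFR x h]; exact (min_le_left _ _).trans h
    · exact (min_le_right _ _).trans (hx₀ (by simpa using h))
  set u : (ι → ℝ) → (ι → ℝ) := fun x => ‖F x‖⁻¹ • F x with hu
  have hu1 : ∀ x, ‖u x‖ = 1 := fun x => by
    simp [hu, norm_smul, inv_mul_cancel₀ (norm_ne_zero_iff.2 (hne x))]
  set G : (ι → ℝ) → (ι → ℝ) := fun x => max R ‖x‖ • u x with hG
  have hGout : ∀ x, R ≤ ‖x‖ → G x = x := fun x hx => by
    have : ‖x‖ ≠ 0 := (hR.trans_le hx).ne'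
    simp [hG, hu, hFR x hx, max_eq_right hx, smul_smul, this]
  have hGin : ∀ x, ‖x‖ ≤ R → ‖G x‖ = R := fun x hx => by
    simp only [hG]
    rw [norm_smul, hu1, max_eq_left hx, Real.norm_of_nonneg hR.le, mul_one]
  have hGlip : ∀ x y, ‖x‖ ≤ ‖y‖ → ‖G x - G y‖ ≤ (1 + R * (2 * C / ε)) * ‖x - y‖ := by
    intro x y hxy
    have hK : 0 ≤ R * (2 * C / ε) * ‖x - y‖ := by positivity
    rcases le_total R ‖x‖ with h | h
    · rw [hGout x h, hGout y (h.trans hxy)]; linarith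
    -- With ‖x‖ ≤ R the radial factor at x is R, so the difference splits into a change of direction
    -- and a change of radius.
    · have e : G x - G y = R • (u x - u y) + (R - max R ‖y‖) • u y := by
        simp only [hG, max_eq_left h, smul_sub, sub_smul]; abel
      have h1 : |R - max R ‖y‖| ≤ ‖x - y‖ := by
        have := norm_sub_norm_le y x
        rw [norm_sub_rev] at this
        rw [abs_le]
        constructor
        · rcases max_choice R ‖y‖ with h' | h' <;> rw [h'] <;> [skip; linarith]
          linarith [norm_nonneg (x - y)]
        · linarith [le_max_left R ‖y‖, norm_nonneg (x - y)]
      have h2 := hF.inv_norm_smul hε hFε x y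
      rw [dist_eq_norm] at h2
      calc ‖G x - G y‖ ≤ ‖R • (u x - u y)‖ + ‖(R - max R ‖y‖) • u y‖ := by
            rw [e]; exact norm_add_le _ _
        _ ≤ R * (2 * C / ε * ‖x - y‖) + ‖x - y‖ := by
            rw [norm_smul, norm_smul, hu1, mul_one, Real.norm_of_nonneg hR.le]
            exact add_le_add (mul_le_mul_of_nonneg_left h2 hR.le) h1
        _ = _ := by ring
  have hGL : LipschitzWith ⟨1 + R * (2 * C / ε), by positivity⟩ G := by
    refine LipschitzWith.of_dist_le_mul fun x y => ?_
    rw [dist_eq_norm, dist_eq_norm]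
    rcases le_total ‖x‖ ‖y‖ with h | h
    · exact hGlip x y h
    · rw [norm_sub_rev, norm_sub_rev x]; exact hGlip y x h
  set D : NNReal := ⟨1 + R * (2 * C / ε), by positivity⟩ + 1 with hD
  set k : (ι → ℝ) → (ι → ℝ) := fun x => G x - x with hk
  have hkL : LipschitzWith D k := hGL.sub LipschitzWith.id
  have hkR : ∀ x, R ≤ ‖x‖ → k x = 0 := fun x hx => by simp [hk, hGout x hx]
  set s := ball (0 : ι → ℝ) R ∩ {x | DifferentiableAt ℝ k x} with hs
  have hsm : MeasurableSet s :=
    measurableSet_ball.inter (measurableSet_of_differentiableAt ℝ k)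
  set n := Module.finrank ℝ (ι → ℝ) with hn
  -- Chosen so that all n + 1 nodes j * c with j ≤ n satisfy j * c * D < 1, the range in which the
  -- volume is preserved.
  set c : ℝ := ((n + 1) * (D + 1))⁻¹ with hc
  have hcpos : 0 < c := by positivity
  set v : ℕ → ℝ := fun j => j * c with hv
  have hvinj : Function.Injective v := fun i j hij => by
    have := mul_right_cancel₀ hcpos.ne' hij
    exact_mod_cast this
  have hvol : 0 < volume.real (ball (0 : ι → ℝ) R) :=
    ENNReal.toReal_pos (measure_ball_pos _ _ hR).ne' measure_ball_lt_top.ne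
  have hint : ∀ j ∈ Finset.range (n + 1), ∫ x in s,
      (ContinuousLinearMap.id ℝ (ι → ℝ) + v j • fderiv ℝ k x).det =
        volume.real (ball (0 : ι → ℝ) R) := by
    intro j hj
    refine hkL.setIntegral_det_id_add_smul hkR (by positivity) ?_
    have hj' : (j : ℝ) < n + 1 := by exact_mod_cast Finset.mem_range.1 hj
    have hD0 : (0 : ℝ) ≤ D := D.coe_nonneg
    simp only [hv, hc]
    rw [← div_eq_mul_inv, div_mul_eq_mul_div, div_lt_one (by positivity)]
    nlinarith
  have hzero : ∀ x ∈ s, (0 : ℝ) = ∑ j ∈ Finset.range (n + 1),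
      (ContinuousLinearMap.id ℝ (ι → ℝ) + v j • fderiv ℝ k x).det *
        (Lagrange.basis (Finset.range (n + 1)) v j).eval 1 := by
    intro x hx
    have h1 := LinearMap.det_id_add_eq_sum_lagrange (fderiv ℝ k x : (ι → ℝ) →ₗ[ℝ] (ι → ℝ)) hvinj
    refine Eq.trans ?_ h1
    have hGd : HasFDerivAt G (ContinuousLinearMap.id ℝ (ι → ℝ) + fderiv ℝ k x) x := by
      refine ((hasFDerivAt_id x).add hx.2.hasFDerivAt).congr_of_eventuallyEq ?_
      exact Eventually.of_forall fun y => by simp [hk]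
    refine (hGd.det_eq_zero_of_norm_eq hR ?_).symm
    filter_upwards [isOpen_ball.mem_nhds hx.1] with y hy
    exact hGin y (by simpa using (mem_ball_zero_iff.1 hy).le)
  -- The weights sum to 1, so equal volumes at all nodes give the same volume at t = 1.
  have hsum : ∑ j ∈ Finset.range (n + 1), (Lagrange.basis (Finset.range (n + 1)) v j).eval 1
      = 1 := by
    rw [← Polynomial.eval_finsetSum, Lagrange.sum_basis hvinj.injOn ⟨0, by simp⟩,
      Polynomial.eval_one]
  have hfin := setIntegral_congr_fun (μ := volume) hsm hzero
  rw [integral_zero, integral_finsetSum] at hfin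
  · rw [Finset.sum_congr rfl fun j hj => by rw [integral_mul_const, hint j hj],
      ← Finset.mul_sum, hsum, mul_one] at hfin
    exact hvol.ne hfin
  · intro j hj
    -- Integrability comes for free: a non-integrable function has integral 0, and this integral is
    -- the positive volume of the ball.
    refine Integrable.mul_const (not_imp_comm.1 integral_undef ?_) _
    rw [hint j hj]
    exact hvol.ne'

-- F is approximated by a C¹ map within the lower bound ε of ‖F‖ and left unchanged far out. The
-- difference from the identity then has compact support, so the approximation is Lipschitz and has
-- a zero, which is too close to F.
open Metric Set in
theorem Continuous.exists_eq_zero_of_eq_self {ι : Type*} [Fintype ι]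
    {F : (ι → ℝ) → (ι → ℝ)} (hF : Continuous F) {R : ℝ} (hR : 0 < R)
    (hFR : ∀ x, R ≤ ‖x‖ → F x = x) : ∃ x, F x = 0 := by
  by_contra! hne
  obtain ⟨ε, hε, hFε⟩ : ∃ ε > 0, ∀ x, ε ≤ ‖F x‖ := by
    obtain ⟨x₀, -, hx₀⟩ := (isCompact_closedBall (0 : ι → ℝ) R).exists_isMinOn
      ⟨0, by simp [hR.le]⟩ hF.norm.continuousOn
    refine ⟨min R ‖F x₀‖, lt_min hR (norm_pos_iff.2 (hne x₀)), fun x => ?_⟩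
    rcases le_total R ‖x‖ with h | h
    · rw [hFR x h]; exact (min_le_left _ _).trans h
    · exact (min_le_right _ _).trans (hx₀ (by simpa using h))
  obtain ⟨g, hg, hgF, hgS, -⟩ := hF.exists_contDiff_approx_and_eqOn 1
    (continuous_const (y := ε)) (fun _ => hε)
    (S := {x | R + 1 ≤ ‖x‖}) (U := {x | R < ‖x‖})
    (isClosed_le continuous_const continuous_norm)
    ((isOpen_lt continuous_const continuous_norm).mem_nhdsSet.2 fun x hx => by
      simp only [mem_ofPred_eq] at hx ⊢; linarith)
    (contDiffOn_id.congr fun x hx => hFR x (le_of_lt hx))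
  have hgout : ∀ x, R + 1 ≤ ‖x‖ → g x = x := fun x hx => by
    rw [hgS hx, hFR x (by linarith)]
  have hsupp : HasCompactSupport fun x => g x - x :=
    HasCompactSupport.intro (isCompact_closedBall 0 (R + 1)) fun x hx => by
      rw [hgout x (by simpa using (not_le.1 (fun h => hx (mem_closedBall_zero_iff.2 h))).le),
        sub_self]
  obtain ⟨C, hC⟩ := ContDiff.lipschitzWith_of_hasCompactSupport (𝕂 := ℝ) hsupp
    (hg.sub contDiff_id) one_ne_zero
  have hgC : LipschitzWith (C + 1) g := by
    simpa using hC.add LipschitzWith.id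
  obtain ⟨x, hx⟩ := hgC.exists_eq_zero_of_eq_self (by linarith : 0 < R + 1) hgout
  have := hgF x
  rw [hx, dist_zero_left] at this
  exact absurd (hFε x) (not_le.2 this)

/-! ### The Poincaré–Miranda theorem -/

open Set in
/-- The Poincaré–Miranda theorem on a box that contains the origin. -/
theorem exists_eq_zero_of_sign_on_faces {ι : Type*} [Fintype ι] {a b : ι → ℝ}
    (ha : a ≤ 0) (hb : 0 ≤ b) {T : (ι → ℝ) → (ι → ℝ)} (hT : ContinuousOn T (Icc a b))
    (hTa : ∀ x ∈ Icc a b, ∀ i, x i = a i → T x i < 0)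
    (hTb : ∀ x ∈ Icc a b, ∀ i, x i = b i → 0 < T x i) : ∃ x ∈ Icc a b, T x = 0 := by
  have hab : a ≤ b := ha.trans hb
  set p : (ι → ℝ) → (ι → ℝ) := fun x => a ⊔ (b ⊓ x) with hp
  have hpc : Continuous p := continuous_pi fun i =>
    continuous_const.max (continuous_const.min (continuous_apply i))
  have hpm : ∀ x, p x ∈ Icc a b := fun x =>
    ⟨le_sup_left, sup_le hab inf_le_left⟩
  have hpid : ∀ x ∈ Icc a b, p x = x := fun x hx => by
    simp [hp, inf_eq_right.2 hx.2, sup_eq_right.2 hx.1]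
  -- χ vanishes on the box and is 1 far out, so F below interpolates between T and the identity.
  set χ : (ι → ℝ) → ℝ := fun x => min 1 ‖x - p x‖ with hχ
  have hχ0 : ∀ x, 0 ≤ χ x := fun x => le_min zero_le_one (norm_nonneg _)
  have hχ1 : ∀ x, χ x ≤ 1 := fun x => min_le_left _ _
  have hχc : Continuous χ := continuous_const.min (continuous_id.sub hpc).norm
  set F : (ι → ℝ) → (ι → ℝ) := fun x => x - (1 - χ x) • p x + (1 - χ x) • T (p x) with hF
  have hFc : Continuous F := by
    have : Continuous fun x => T (p x) := hT.comp_continuous hpc hpm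
    exact (continuous_id.sub ((continuous_const.sub hχc).smul hpc)).add
      ((continuous_const.sub hχc).smul this)
  obtain ⟨B, hB⟩ : ∃ B, ∀ x, ‖p x‖ ≤ B := by
    obtain ⟨B, hB⟩ := (isCompact_Icc (a := a) (b := b)).isBounded.exists_norm_le
    exact ⟨B, fun x => hB _ (hpm x)⟩
  have hB0 : 0 ≤ B := (norm_nonneg _).trans (hB 0)
  obtain ⟨x, hx⟩ := hFc.exists_eq_zero_of_eq_self (R := B + 1) (by linarith) fun x hx => by
    have : χ x = 1 := by
      refine min_eq_left ?_
      have := norm_sub_norm_le x (p x)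
      linarith [hB x]
    simp [hF, this]
  have hxi : ∀ i, x i - (1 - χ x) * p x i + (1 - χ x) * T (p x) i = 0 := fun i => by
    simpa [hF] using congrFun hx i
  -- If x i < a i, then p x i = a i and T (p x) i < 0, and the equation gives x i ≥ (1 - χ x) a i ≥
  -- a i because a i ≤ 0. The upper faces are symmetric; this is where the origin must lie in the
  -- box.
  have hxm : x ∈ Icc a b := by
    by_contra hxm
    rw [mem_Icc, not_and_or, Pi.le_def, Pi.le_def, not_forall, not_forall] at hxm
    rcases hxm with ⟨i, hi⟩ | ⟨i, hi⟩ <;> rw [not_le] at hi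
    · have hpi : p x i = a i := by
        simp only [hp, Pi.sup_apply, Pi.inf_apply]
        exact sup_eq_left.2 (inf_le_right.trans hi.le)
      have h1 := hTa _ (hpm x) i hpi
      have h2 := hxi i
      have h3 : a i ≤ 0 := ha i
      rw [hpi] at h2
      nlinarith [hχ0 x, hχ1 x]
    · have hpi : p x i = b i := by
        simp only [hp, Pi.sup_apply, Pi.inf_apply]
        rw [inf_eq_left.2 hi.le]
        exact sup_eq_right.2 (hab i)
      have h1 := hTb _ (hpm x) i hpi
      have h2 := hxi i
      have h3 : 0 ≤ b i := hb i
      rw [hpi] at h2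
      nlinarith [hχ0 x, hχ1 x]
  refine ⟨x, hxm, ?_⟩
  have hχx : χ x = 0 := by simp [hχ, hpid x hxm]
  simpa [hF, hχx, hpid x hxm] using hx

/-! ### Tangents to the fibre of a differentiable map of constant rank -/

theorem ContinuousLinearMap.det_comp_eq_zero_of_finrank_range_lt {V W : Type*}
    [NormedAddCommGroup V] [NormedSpace ℝ V] [FiniteDimensional ℝ V] [NormedAddCommGroup W]
    [NormedSpace ℝ W] (L : W →L[ℝ] V) (M : V →L[ℝ] W)
    (hM : Module.finrank ℝ (LinearMap.range (M : V →ₗ[ℝ] W)) < Module.finrank ℝ V) :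
    (L.comp M).det = 0 := by
  by_contra hdet
  have hsurj : Function.Surjective (L.comp M) :=
    (LinearMap.equivOfDetNeZero (L.comp M : V →ₗ[ℝ] V) hdet).surjective
  have h1 : Submodule.map (L : W →ₗ[ℝ] V) (LinearMap.range (M : V →ₗ[ℝ] W)) = ⊤ := by
    rw [← LinearMap.range_comp, LinearMap.range_eq_top]
    exact hsurj
  have h2 := Submodule.finrank_map_le (L : W →ₗ[ℝ] V) (LinearMap.range (M : V →ₗ[ℝ] W))
  rw [h1, finrank_top] at h2
  omega

open MeasureTheory Metric Set in
/-- A map of deficient rank whose projection `P ∘ γ` is, at the origin, tangent to the projection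
forgetting the coordinate `none` vanishes somewhere on each small slice `z none = τ`. -/
theorem exists_eq_zero_on_slice {r m : ℕ} {γ : (Option (Fin r) → ℝ) → (Fin m → ℝ)}
    (P : (Fin m → ℝ) →L[ℝ] (Fin r → ℝ))
    (hγ0 : γ 0 = 0) (hγ : ∀ᶠ z in 𝓝 0, DifferentiableAt ℝ γ z)
    (hrank : ∀ᶠ z in 𝓝 0, Module.finrank ℝ (LinearMap.range
      (fderiv ℝ γ z : (Option (Fin r) → ℝ) →ₗ[ℝ] (Fin m → ℝ))) ≤ r)
    (hP : ∀ z i, P (fderiv ℝ γ 0 z) i = z (some i)) {δ : ℝ} (hδ0 : 0 < δ) (hδ1 : δ ≤ 1) :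
    ∀ᶠ τ in 𝓝[>] (0 : ℝ), ∃ z, z none = τ ∧ (∀ i, |z (some i)| ≤ δ * τ) ∧ γ z = 0 := by
  have hd0 := hγ.self_of_nhds.hasFDerivAt
  obtain ⟨C, hC0, hC⟩ : ∃ C > 0, ∀ᶠ z in 𝓝 0, ‖γ z‖ ≤ C * ‖z‖ := by
    have := hd0.isBigO_sub.exists_pos
    obtain ⟨C, hC0, hC⟩ := this
    refine ⟨C, hC0, ?_⟩
    simpa [hγ0] using hC.bound
  have hPo : ∀ᶠ z in 𝓝 (0 : Option (Fin r) → ℝ),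
      ‖P (γ z) - P (fderiv ℝ γ 0 z)‖ ≤ δ / 2 * ‖z‖ := by
    have := (P.hasFDerivAt.comp 0 hd0).isLittleO.bound (half_pos hδ0)
    simpa [hγ0] using this
  obtain ⟨ρ, hρ0, hρ⟩ := Metric.eventually_nhds_iff_ball.1 (hγ.and (hrank.and (hC.and hPo)))
  filter_upwards [Ioo_mem_nhdsGT hρ0] with τ hτ
  obtain ⟨hτ0, hτρ⟩ := hτ
  by_contra! hno
  set lo : Option (Fin r) → ℝ := fun o => o.elim 0 fun _ => -(δ * τ) with hlo
  set hi : Option (Fin r) → ℝ := fun o => o.elim τ fun _ => δ * τ with hhi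
  have hδτ : 0 < δ * τ := by positivity
  have hδτ' : δ * τ ≤ τ := by nlinarith
  set Q := Icc lo hi with hQ
  have hQ1 : ∀ z ∈ Q, 0 ≤ z none ∧ z none ≤ τ := fun z hz => ⟨hz.1 none, hz.2 none⟩
  have hQ2 : ∀ z ∈ Q, ∀ i, |z (some i)| ≤ δ * τ := fun z hz i =>
    abs_le.2 ⟨hz.1 (some i), hz.2 (some i)⟩
  have hQn : ∀ z ∈ Q, ‖z‖ ≤ τ := fun z hz => by
    refine (pi_norm_le_iff_of_nonneg hτ0.le).2 fun o => ?_
    cases o with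
    | none => rw [Real.norm_eq_abs, abs_of_nonneg (hQ1 z hz).1]; exact (hQ1 z hz).2
    | some i => exact (hQ2 z hz i).trans hδτ'
  have hQρ : ∀ z ∈ Q, z ∈ ball (0 : Option (Fin r) → ℝ) ρ := fun z hz =>
    mem_ball_zero_iff.2 ((hQn z hz).trans_lt hτρ)
  have hγc : ContinuousOn γ Q := fun z hz =>
    (hρ z (hQρ z hz)).1.continuousAt.continuousWithinAt
  set q : (Fin m → ℝ) → ℝ := fun w => ∑ j, w j ^ 2 with hq
  have hqd : Differentiable ℝ q := by
    simp only [hq]; fun_prop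
  have hqpos : ∀ w, w ≠ 0 → 0 < q w := fun w hw => by
    obtain ⟨j, hj⟩ := Function.ne_iff.1 hw
    exact Finset.sum_pos' (fun _ _ => sq_nonneg _) ⟨j, Finset.mem_univ _, by
      have : w j ≠ 0 := hj
      positivity⟩
  have hqle : ∀ w, q w ≤ m * ‖w‖ ^ 2 := fun w => by
    have : ∀ j ∈ Finset.univ, w j ^ 2 ≤ ‖w‖ ^ 2 := fun j _ => by
      rw [← sq_abs]
      exact pow_le_pow_left₀ (abs_nonneg _) (norm_le_pi_norm w j) 2
    simpa using Finset.sum_le_sum this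
  -- a positive lower bound on the face `z none = τ`
  obtain ⟨ε, hε0, hε⟩ : ∃ ε > 0, ∀ z ∈ Q, z none = τ → ε ≤ q (γ z) := by
    have hcomp : IsCompact (Q ∩ {z | z none = τ}) :=
      isCompact_Icc.inter_right (isClosed_eq (continuous_apply none) continuous_const)
    obtain ⟨z₀, hz₀, hmin⟩ := hcomp.exists_isMinOn (f := fun z => q (γ z))
      ⟨fun o => o.elim τ fun _ => 0, ⟨fun o => by cases o <;> simp [hlo, hτ0.le, hδτ.le],
        fun o => by cases o <;> simp [hhi, hδτ.le]⟩, rfl⟩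
      (hqd.continuous.comp_continuousOn (hγc.mono inter_subset_left))
    refine ⟨q (γ z₀), hqpos _ (hno z₀ hz₀.2 (hQ2 z₀ hz₀.1)), fun z hz hzτ => hmin ⟨hz, hzτ⟩⟩
  -- The factor m C² bounds q (γ z) by ‖z‖², and 8 comes from ‖z‖² ≤ 8 (N z + ∑ w²) on the face `z
  -- none = 0`.
  set M : ℝ := 8 * m * C ^ 2 with hM
  have hM0 : 0 ≤ M := by positivity
  set Ψ : (Fin m → ℝ) → (Option (Fin r) → ℝ) := fun w o => o.elim (q w) (P w) with hΨ
  have hΨd : Differentiable ℝ Ψ := by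
    refine differentiable_pi.2 fun o => ?_
    cases o with
    | none => exact hqd
    | some i => exact differentiable_pi.1 P.differentiable i
  -- The composite maps r + 1 variables to r + 1 variables but factors through rank at most r, so
  -- its determinant vanishes on Q. This form of Sard's theorem needs only differentiability.
  have hnull : volume ((Ψ ∘ γ) '' Q) = 0 := by
    refine addHaar_image_eq_zero_of_det_fderivWithin_eq_zero volume
      (f' := fun z => (fderiv ℝ Ψ (γ z)).comp (fderiv ℝ γ z)) (fun z hz => ?_) fun z hz => ?_
    · exact ((hΨd _).hasFDerivAt.comp z (hρ z (hQρ z hz)).1.hasFDerivAt).hasFDerivWithinAt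
    · refine ContinuousLinearMap.det_comp_eq_zero_of_finrank_range_lt _ _ ?_
      refine (hρ z (hQρ z hz)).2.1.trans_lt ?_
      simp
  -- Every point of this nonempty open set will be shown to be a value of Ψ ∘ γ on Q, contradicting
  -- nullity.
  set O : Set (Option (Fin r) → ℝ) := {w | 0 < w none ∧ w none < ε ∧
    M * ∑ i, w (some i) ^ 2 < w none ∧ ∀ i, |w (some i)| < δ * τ / 2} with hO
  have hOo : IsOpen O := by
    have h1 : IsOpen {w : Option (Fin r) → ℝ | ∀ i, |w (some i)| < δ * τ / 2} := by
      simp only [ofPred_forall]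
      exact isOpen_iInter_of_finite fun i => isOpen_lt (by fun_prop) continuous_const
    refine (isOpen_lt continuous_const (continuous_apply none)).inter
      ((isOpen_lt (continuous_apply none) continuous_const).inter
        ((isOpen_lt ?_ (continuous_apply none)).inter h1))
    fun_prop
  have hOne : O.Nonempty := ⟨fun o => o.elim (ε / 2) fun _ => 0, by
    simp [hO, hε0, hδτ]⟩
  refine (hOo.measure_pos volume hOne).ne' (measure_mono_null (fun w hw => ?_) hnull)
  obtain ⟨hw0, hwε, hwM, hwδ⟩ := hw
  set N : (Option (Fin r) → ℝ) → ℝ := fun z => ∑ i, (P (γ z) i - w (some i)) ^ 2 with hN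
  have hN0 : ∀ z, 0 ≤ N z := fun z => Finset.sum_nonneg fun _ _ => sq_nonneg _
  have hPi : ∀ z ∈ Q, ∀ i, |P (γ z) i - z (some i)| ≤ δ * ‖z‖ / 2 := fun z hz i => by
    have h1 := (hρ z (hQρ z hz)).2.2.2
    have h2 := norm_le_pi_norm (P (γ z) - P (fderiv ℝ γ 0 z)) i
    rw [Pi.sub_apply, hP, Real.norm_eq_abs] at h2
    linarith
  have hPcont : ContinuousOn (fun z => P (γ z)) Q := P.continuous.comp_continuousOn hγc
  have hPic : ∀ i, ContinuousOn (fun z => P (γ z) i) Q := fun i =>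
    (continuous_apply i).comp_continuousOn hPcont
  -- The correction M (1 - z none / τ) N z forces the sign on the face `z none = 0`, disappears on
  -- `z none = τ`, and is 0 at the solution since N z = 0 there. The zero therefore solves the
  -- uncorrected system.
  obtain ⟨z, hzQ, hz⟩ := exists_eq_zero_of_sign_on_faces (a := lo) (b := hi)
    (T := fun z o => o.elim (q (γ z) - w none - M * (1 - z none / τ) * N z)
      fun i => P (γ z) i - w (some i))
    (fun o => by cases o <;> simp [hlo, hδτ.le]) (fun o => by cases o <;> simp [hhi, hτ0.le, hδτ.le])
    (by
      refine continuousOn_pi.2 fun o => ?_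
      cases o with
      | none =>
        have h1 : ContinuousOn N Q :=
          continuousOn_finsetSum _ fun i _ => ((hPic i).sub continuousOn_const).pow 2
        have h2 : ContinuousOn (fun z => q (γ z)) Q := hqd.continuous.comp_continuousOn hγc
        refine (h2.sub continuousOn_const).sub (ContinuousOn.mul ?_ h1)
        exact Continuous.continuousOn (by fun_prop)
      | some i => exact (hPic i).sub continuousOn_const)
    (by
      intro z hz o hzo
      have hzn := hQn z hz
      cases o with
      | none =>
        have hz0 : z none = 0 := hzo
        have hsum : ‖z‖ ^ 2 ≤ 8 * (N z + ∑ i, w (some i) ^ 2) := by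
          set X := N z + ∑ i, w (some i) ^ 2 with hX
          have hX0 : 0 ≤ X := add_nonneg (hN0 z) (Finset.sum_nonneg fun _ _ => sq_nonneg _)
          have hPX : ∀ i, |P (γ z) i| ≤ √(2 * X) := fun i => by
            refine Real.abs_le_sqrt ?_
            have h1 : (P (γ z) i - w (some i)) ^ 2 ≤ N z :=
              Finset.single_le_sum (f := fun i => (P (γ z) i - w (some i)) ^ 2)
                (fun _ _ => sq_nonneg _) (Finset.mem_univ i)
            have h2 : w (some i) ^ 2 ≤ ∑ i, w (some i) ^ 2 :=
              Finset.single_le_sum (f := fun i => w (some i) ^ 2)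
                (fun _ _ => sq_nonneg _) (Finset.mem_univ i)
            nlinarith [sq_nonneg (P (γ z) i - 2 * w (some i))]
          -- With the coordinate `none` equal to 0, z agrees with P (γ z) up to half its own norm,
          -- so that half can be absorbed.
          have hle : ‖z‖ ≤ √(2 * X) + ‖z‖ / 2 := by
            refine (pi_norm_le_iff_of_nonneg (by positivity)).2 fun o => ?_
            cases o with
            | none => rw [hz0, norm_zero]; positivity
            | some i =>
              have h1 := hPi z hz i
              have h2 := abs_sub_abs_le_abs_sub (z (some i)) (P (γ z) i)
              rw [abs_sub_comm] at h2
              have h3 := hPX i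
              rw [Real.norm_eq_abs]
              nlinarith [norm_nonneg z]
          have h4 : ‖z‖ ^ 2 ≤ (2 * √(2 * X)) ^ 2 :=
            pow_le_pow_left₀ (norm_nonneg z) (by linarith) 2
          rw [mul_pow, Real.sq_sqrt (by positivity)] at h4
          linarith
        have h2 : q (γ z) ≤ m * (C * ‖z‖) ^ 2 :=
          (hqle _).trans (by gcongr; exact (hρ z (hQρ z hz)).2.2.1)
        have h3 : m * (C * ‖z‖) ^ 2 ≤ m * C ^ 2 * (8 * (N z + ∑ i, w (some i) ^ 2)) := by
          rw [mul_pow, ← mul_assoc]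
          gcongr
        show q (γ z) - w none - M * (1 - z none / τ) * N z < 0
        rw [hz0, zero_div, sub_zero, mul_one]
        simp only [hM] at hwM ⊢
        linarith
      | some i =>
        have hz0 : z (some i) = -(δ * τ) := hzo
        have h1 := (abs_le.1 (hPi z hz i)).2
        have h2 := (abs_lt.1 (hwδ i)).1
        show P (γ z) i - w (some i) < 0
        nlinarith)
    (by
      intro z hz o hzo
      have hzn := hQn z hz
      cases o with
      | none =>
        have hz0 : z none = τ := hzo
        show 0 < q (γ z) - w none - M * (1 - z none / τ) * N z
        rw [hz0, div_self hτ0.ne', sub_self, mul_zero, zero_mul, sub_zero]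
        linarith [hε z hz hz0]
      | some i =>
        have hz0 : z (some i) = δ * τ := hzo
        have h1 := (abs_le.1 (hPi z hz i)).1
        have h2 := (abs_lt.1 (hwδ i)).2
        show 0 < P (γ z) i - w (some i)
        nlinarith)
  have hz1 : ∀ i, P (γ z) i - w (some i) = 0 := fun i => congrFun hz (some i)
  have hz2 : q (γ z) - w none - M * (1 - z none / τ) * N z = 0 := congrFun hz none
  refine ⟨z, hzQ, ?_⟩
  funext o
  cases o with
  | none =>
    have : N z = 0 := Finset.sum_eq_zero fun i _ => by rw [hz1 i]; ring
    rw [this, mul_zero, sub_zero] at hz2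
    exact sub_eq_zero.1 hz2
  | some i => exact sub_eq_zero.1 (hz1 i)

/-- Supplies r coordinates P on the target and r transversal directions J in the source on which A
looks like the identity. -/
theorem LinearMap.exists_projection_section {E W : Type*} [AddCommGroup E] [Module ℝ E]
    [AddCommGroup W] [Module ℝ W] [FiniteDimensional ℝ W] (A : E →ₗ[ℝ] W) :
    ∃ (P : W →ₗ[ℝ] (Fin (Module.finrank ℝ (LinearMap.range A)) → ℝ))
      (J : (Fin (Module.finrank ℝ (LinearMap.range A)) → ℝ) →ₗ[ℝ] E), ∀ y, P (A (J y)) = y := by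
  let e : LinearMap.range A ≃ₗ[ℝ] (Fin (Module.finrank ℝ (LinearMap.range A)) → ℝ) :=
    (Module.finBasis ℝ (LinearMap.range A)).equivFun
  obtain ⟨P, hP⟩ := LinearMap.exists_leftInverse_of_injective
    ((LinearMap.range A).subtype ∘ₗ e.symm.toLinearMap)
    (LinearMap.ker_eq_bot.2 ((Submodule.subtype_injective _).comp e.symm.injective))
  obtain ⟨J, hJ⟩ := LinearMap.exists_rightInverse_of_surjective
    (e.toLinearMap ∘ₗ A.rangeRestrict)
    (LinearMap.range_eq_top.2 (e.surjective.comp A.surjective_rangeRestrict))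
  refine ⟨P, J, fun y => ?_⟩
  have h1 : e (A.rangeRestrict (J y)) = y := LinearMap.congr_fun hJ y
  have h2 : P (e.symm (e (A.rangeRestrict (J y)))) = e (A.rangeRestrict (J y)) :=
    LinearMap.congr_fun hP _
  rw [e.symm_apply_apply, h1] at h2
  exact h2

/-- If the rank of the derivative of `g` does not exceed near `x₀` its value at `x₀`, then each
vector of the kernel of the derivative at `x₀` is tangent to the fibre `{g = 0}`. The map `g` is
only assumed to be differentiable. -/
theorem eventually_exists_eq_zero_near_tangent {E : Type*} [NormedAddCommGroup E]
    [NormedSpace ℝ E] [FiniteDimensional ℝ E] {m : ℕ} {g : E → Fin m → ℝ} {x₀ : E}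
    (hg0 : g x₀ = 0) (hg : ∀ᶠ y in 𝓝 x₀, DifferentiableAt ℝ g y)
    (hrank : ∀ᶠ y in 𝓝 x₀, Module.finrank ℝ (LinearMap.range (fderiv ℝ g y : E →ₗ[ℝ] Fin m → ℝ))
      ≤ Module.finrank ℝ (LinearMap.range (fderiv ℝ g x₀ : E →ₗ[ℝ] Fin m → ℝ)))
    {v : E} (hv : fderiv ℝ g x₀ v = 0) {δ : ℝ} (hδ : 0 < δ) :
    ∀ᶠ τ in 𝓝[>] (0 : ℝ), ∃ x, g x = 0 ∧ ‖x - x₀ - τ • v‖ ≤ δ * τ := by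
  set r := Module.finrank ℝ (LinearMap.range (fderiv ℝ g x₀ : E →ₗ[ℝ] Fin m → ℝ)) with hr
  obtain ⟨P, J, hPJ⟩ := LinearMap.exists_projection_section (fderiv ℝ g x₀ : E →ₗ[ℝ] Fin m → ℝ)
  set J' : (Fin r → ℝ) →L[ℝ] E := LinearMap.toContinuousLinearMap J with hJ'
  set S : (Option (Fin r) → ℝ) →L[ℝ] (Fin r → ℝ) :=
    ContinuousLinearMap.pi fun i => ContinuousLinearMap.proj (some i) with hS
  set Λ : (Option (Fin r) → ℝ) →L[ℝ] E :=
    J'.comp S + (ContinuousLinearMap.proj none).smulRight v with hΛ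
  have hΛz : ∀ z, Λ z = J' (S z) + z none • v := fun z => by simp [hΛ]
  set γ : (Option (Fin r) → ℝ) → (Fin m → ℝ) := fun z => g (x₀ + Λ z) with hγ
  have htend : Tendsto (fun z => x₀ + Λ z) (𝓝 0) (𝓝 x₀) := by
    have : Continuous fun z => x₀ + Λ z := by fun_prop
    simpa using this.tendsto 0
  have hγd : ∀ z, DifferentiableAt ℝ g (x₀ + Λ z) →
      HasFDerivAt γ ((fderiv ℝ g (x₀ + Λ z)).comp Λ) z := fun z hz =>
    hz.hasFDerivAt.comp z (Λ.hasFDerivAt.const_add x₀)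
  -- The deviation from τ • v is J' applied to a vector of norm at most δ' τ; dividing by ‖J'‖ + 1
  -- avoids a zero denominator.
  set δ' : ℝ := min 1 (δ / (‖J'‖ + 1)) with hδ'
  have hδ'0 : 0 < δ' := lt_min one_pos (by positivity)
  have key := exists_eq_zero_on_slice (γ := γ) (LinearMap.toContinuousLinearMap P)
    (by simp [hγ, hg0]) ((htend.eventually hg).mono fun z hz => (hγd z hz).differentiableAt)
    ((htend.eventually (hg.and hrank)).mono fun z hz => by
      rw [(hγd z hz.1).fderiv]
      refine le_trans (Submodule.finrank_mono ?_) hz.2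
      exact LinearMap.range_comp_le_range _ _)
    (fun z i => by
      rw [(hγd 0 (by simpa using hg.self_of_nhds)).fderiv]
      have h1 : fderiv ℝ g x₀ (Λ z) = fderiv ℝ g x₀ (J (S z)) := by
        rw [hΛz, map_add, map_smul, hv, smul_zero, add_zero]; rfl
      have h2 : P (fderiv ℝ g x₀ (J (S z))) i = z (some i) := congrFun (hPJ (S z)) i
      simpa [h1] using h2)
    hδ'0 (min_le_left _ _)
  filter_upwards [key, self_mem_nhdsWithin] with τ hτ hτ0
  have hτ0' : (0 : ℝ) < τ := hτ0
  obtain ⟨z, hz0, hz, hγz⟩ := hτ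
  refine ⟨x₀ + Λ z, hγz, ?_⟩
  have e : x₀ + Λ z - x₀ - τ • v = J' (S z) := by rw [hΛz, hz0]; abel
  have hSz : ‖S z‖ ≤ δ' * τ := (pi_norm_le_iff_of_nonneg (by positivity)).2 hz
  rw [e]
  calc ‖J' (S z)‖ ≤ ‖J'‖ * ‖S z‖ := J'.le_opNorm _
    _ ≤ (‖J'‖ + 1) * (δ / (‖J'‖ + 1) * τ) := by
        refine mul_le_mul (by linarith) (hSz.trans ?_) (norm_nonneg _) (by positivity)
        exact mul_le_mul_of_nonneg_right (min_le_right _ _) hτ0'.le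
    _ = δ * τ := by field_simp

theorem exists_seq_eq_zero_tangent {E : Type*} [NormedAddCommGroup E]
    [NormedSpace ℝ E] [FiniteDimensional ℝ E] {m : ℕ} {g : E → Fin m → ℝ} {x₀ : E}
    (hg0 : g x₀ = 0) (hg : ∀ᶠ y in 𝓝 x₀, DifferentiableAt ℝ g y)
    (hrank : ∀ᶠ y in 𝓝 x₀, Module.finrank ℝ (LinearMap.range (fderiv ℝ g y : E →ₗ[ℝ] Fin m → ℝ))
      ≤ Module.finrank ℝ (LinearMap.range (fderiv ℝ g x₀ : E →ₗ[ℝ] Fin m → ℝ)))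
    {v : E} (hv : fderiv ℝ g x₀ v = 0) :
    ∃ (t : ℕ → ℝ) (w : ℕ → E), (∀ k, 0 < t k) ∧ Tendsto t atTop (𝓝 0) ∧ Tendsto w atTop (𝓝 v) ∧
      ∀ k, g (x₀ + t k • w k) = 0 := by
  have hex : ∀ k : ℕ, ∃ (t : ℝ) (w : E), 0 < t ∧ t < 1 / ((k : ℝ) + 1) ∧
      ‖w - v‖ ≤ 1 / ((k : ℝ) + 1) ∧ g (x₀ + t • w) = 0 := fun k => by
    have hk : (0 : ℝ) < 1 / ((k : ℝ) + 1) := by positivity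
    obtain ⟨t, ⟨x, hx, hxt⟩, ht⟩ := ((eventually_exists_eq_zero_near_tangent hg0 hg hrank hv hk).and
      (Ioo_mem_nhdsGT hk)).exists
    have ht0 : 0 < t := ht.1
    have e : x - x₀ = t • (t⁻¹ • (x - x₀)) := by rw [smul_smul, mul_inv_cancel₀ ht0.ne', one_smul]
    refine ⟨t, t⁻¹ • (x - x₀), ht.1, ht.2, ?_, ?_⟩
    · rw [e, ← smul_sub, norm_smul, Real.norm_of_nonneg ht0.le, mul_comm] at hxt
      exact le_of_mul_le_mul_right hxt ht0
    · rw [← e, add_sub_cancel, hx]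
  choose t w ht0 ht hw hgw using hex
  have hlim : Tendsto (fun k : ℕ => 1 / ((k : ℝ) + 1)) atTop (𝓝 0) :=
    tendsto_one_div_add_atTop_nhds_zero_nat
  refine ⟨t, w, ht0, squeeze_zero (fun k => (ht0 k).le) (fun k => (ht k).le) hlim, ?_, hgw⟩
  rw [tendsto_iff_norm_sub_tendsto_zero]
  exact squeeze_zero (fun k => norm_nonneg _) hw hlim

/-! ### Necessary optimality conditions under constant rank -/

theorem fderiv_pi_component {E : Type*} [NormedAddCommGroup E] [NormedSpace ℝ E] {m : ℕ}
    {g : E → Fin m → ℝ} {x : E} (hg : DifferentiableAt ℝ g x) (i : Fin m) :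
    fderiv ℝ (fun z => g z i) x = (ContinuousLinearMap.proj i).comp (fderiv ℝ g x) :=
  (hasFDerivAt_pi'.1 hg.hasFDerivAt i).fderiv

/-- The gradients are the images of the coordinate forms under the transpose of Dg(x), so their span
is its range, and transposition preserves rank. -/
theorem gradientRank_eq_finrank_range {E : Type*} [NormedAddCommGroup E] [InnerProductSpace ℝ E]
    {m : ℕ} {g : E → Fin m → ℝ} {x : E} (hg : DifferentiableAt ℝ g x) :
    gradientRank g x =
      Module.finrank ℝ (LinearMap.range (fderiv ℝ g x : E →ₗ[ℝ] Fin m → ℝ)) := by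
  set A : E →ₗ[ℝ] Fin m → ℝ := (fderiv ℝ g x : E →ₗ[ℝ] Fin m → ℝ) with hA
  set c : StrongDual ℝ E →ₗ[ℝ] Module.Dual ℝ E := ContinuousLinearMap.coeLM ℝ with hc
  have hcinj : Function.Injective c := ContinuousLinearMap.coe_injective
  have h1 : Submodule.map c (Submodule.span ℝ
      (Set.range fun i : Fin m => fderiv ℝ (fun z => g z i) x)) = LinearMap.range A.dualMap := by
    have htop : (⊤ : Submodule ℝ (Module.Dual ℝ (Fin m → ℝ))) =
        Submodule.span ℝ (Set.range fun i : Fin m => LinearMap.proj i) := by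
      rw [← (Pi.basisFun ℝ (Fin m)).dualBasis.span_eq]
      congr 1
      refine congrArg _ (funext fun i => ?_)
      ext j
      simp
    rw [LinearMap.range_eq_map, htop, Submodule.map_span, Submodule.map_span, ← Set.range_comp,
      ← Set.range_comp]
    congr 2
    funext i
    simp only [Function.comp, fderiv_pi_component hg]
    rfl
  rw [gradientRank, Set.finrank, ← LinearMap.finrank_range_dualMap_eq_finrank_range, ← h1]
  exact (Submodule.equivMapOfInjective c hcinj _).finrank_eq

theorem HasFDerivAt.tendsto_inv_smul_sub {E : Type*} [NormedAddCommGroup E] [NormedSpace ℝ E]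
    {φ : E → ℝ} {φ' : E →L[ℝ] ℝ} {x₀ v : E} (hφ : HasFDerivAt φ φ' x₀) {t : ℕ → ℝ} {w : ℕ → E}
    (ht0 : ∀ k, 0 < t k) (ht : Tendsto t atTop (𝓝 0)) (hw : Tendsto w atTop (𝓝 v)) :
    Tendsto (fun k => (t k)⁻¹ * (φ (x₀ + t k • w k) - φ x₀)) atTop (𝓝 (φ' v)) := by
  refine (hasFDerivWithinAt_univ.2 hφ).lim (c := fun k => (t k)⁻¹) (d := fun k => t k • w k)
    (by simpa using ht.smul hw) (.of_forall fun _ => Set.mem_univ _) ?_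
  refine hw.congr fun k => ?_
  rw [smul_smul, inv_mul_cancel₀ (ht0 k).ne', one_smul]

/-- The second order Taylor formula at a critical point. -/
theorem eventually_abs_sub_half_secondDeriv_le {E : Type*} [NormedAddCommGroup E]
    [NormedSpace ℝ E] {L : E → ℝ} {x₀ : E} (hL : ∀ᶠ y in 𝓝 x₀, DifferentiableAt ℝ L y)
    (hL2 : DifferentiableAt ℝ (fderiv ℝ L) x₀) (hL0 : fderiv ℝ L x₀ = 0) {ε : ℝ} (hε : 0 < ε) :
    ∀ᶠ u in 𝓝 (0 : E), |L (x₀ + u) - L x₀ - secondDeriv L x₀ u u / 2| ≤ ε * ‖u‖ ^ 2 := by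
  have h1 := hL2.hasFDerivAt.isLittleO.bound hε
  rw [hL0] at h1
  obtain ⟨ρ, hρ0, hρ⟩ := Metric.eventually_nhds_iff_ball.1 (hL.and h1)
  refine Metric.eventually_nhds_iff_ball.2 ⟨ρ, hρ0, fun u hu => ?_⟩
  rw [mem_ball_zero_iff] at hu
  have hmem : ∀ s ∈ Set.Icc (0 : ℝ) 1, x₀ + s • u ∈ Metric.ball x₀ ρ := fun s hs => by
    rw [mem_ball_iff_norm, add_sub_cancel_left, norm_smul, Real.norm_of_nonneg hs.1]
    nlinarith [norm_nonneg u, hs.2]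
  -- After the quadratic term is subtracted along the segment, differentiability of the gradient at
  -- x₀ alone bounds the derivative by ε‖u‖²; no continuity of the second derivative is needed.
  have key := norm_image_sub_le_of_norm_deriv_le_segment_01' (C := ε * ‖u‖ ^ 2)
    (f := fun s : ℝ => L (x₀ + s • u) - s ^ 2 * (secondDeriv L x₀ u u / 2))
    (f' := fun s => fderiv ℝ L (x₀ + s • u) u - s * secondDeriv L x₀ u u)
    (fun s hs => by
      have hl : HasDerivAt (fun s : ℝ => x₀ + s • u) u s := by
        simpa using ((hasDerivAt_id s).smul_const u).const_add x₀
      have := ((hρ _ (hmem s hs)).1.hasFDerivAt.comp_hasDerivAt s hl).sub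
        ((hasDerivAt_pow 2 s).mul_const (secondDeriv L x₀ u u / 2))
      refine (this.congr_deriv ?_).hasDerivWithinAt
      simp; ring)
    (fun s hs => by
      have h2 := (hρ _ (hmem s ⟨hs.1, hs.2.le⟩)).2
      rw [add_sub_cancel_left, sub_zero, map_smul, norm_smul s, Real.norm_of_nonneg hs.1] at h2
      have h3 := ContinuousLinearMap.le_of_opNorm_le _ h2 u
      have e : fderiv ℝ L (x₀ + s • u) u - s * secondDeriv L x₀ u u =
          (fderiv ℝ L (x₀ + s • u) - s • fderiv ℝ (fderiv ℝ L) x₀ u) u := rfl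
      rw [e]
      refine h3.trans ?_
      have : 0 ≤ ε * ‖u‖ ^ 2 := by positivity
      nlinarith [hs.2])
  simpa [sub_right_comm] using key

/-- As DL(x₀) = 0, the error w - v contributes nothing at order t², so convergence of directions
suffices and no curvature of the fibre enters. -/
theorem secondDeriv_nonneg_of_tangent {E : Type*} [NormedAddCommGroup E] [NormedSpace ℝ E]
    {L : E → ℝ} {x₀ v : E} (hL : ∀ᶠ y in 𝓝 x₀, DifferentiableAt ℝ L y)
    (hL2 : DifferentiableAt ℝ (fderiv ℝ L) x₀) (hL0 : fderiv ℝ L x₀ = 0)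
    {t : ℕ → ℝ} {w : ℕ → E} (ht0 : ∀ k, 0 < t k) (ht : Tendsto t atTop (𝓝 0))
    (hw : Tendsto w atTop (𝓝 v)) (hmin : ∀ᶠ k in atTop, L x₀ ≤ L (x₀ + t k • w k)) :
    0 ≤ secondDeriv L x₀ v v := by
  have hlim : Tendsto (fun k => t k • w k) atTop (𝓝 0) := by simpa using ht.smul hw
  have hε : ∀ ε > 0, 0 ≤ secondDeriv L x₀ v v / 2 + ε * ‖v‖ ^ 2 := fun ε hε => by
    have hB : Tendsto (fun k => secondDeriv L x₀ (w k) (w k) / 2 + ε * ‖w k‖ ^ 2) atTop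
        (𝓝 (secondDeriv L x₀ v v / 2 + ε * ‖v‖ ^ 2)) := by
      have : Continuous fun w : E => secondDeriv L x₀ w w / 2 + ε * ‖w‖ ^ 2 := by
        unfold secondDeriv; fun_prop
      exact (this.tendsto v).comp hw
    refine ge_of_tendsto hB ?_
    filter_upwards [hlim.eventually (eventually_abs_sub_half_secondDeriv_le hL hL2 hL0 hε), hmin]
      with k hk hk2
    have h1 := (abs_le.1 hk).2
    have e : secondDeriv L x₀ (t k • w k) (t k • w k) = t k ^ 2 * secondDeriv L x₀ (w k) (w k) := by
      simp [secondDeriv]; ring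
    rw [e, norm_smul, Real.norm_of_nonneg (ht0 k).le] at h1
    have h2 : 0 ≤ t k ^ 2 * (secondDeriv L x₀ (w k) (w k) / 2 + ε * ‖w k‖ ^ 2) := by nlinarith
    exact nonneg_of_mul_nonneg_right h2 (pow_pos (ht0 k) 2)
  have hl : Tendsto (fun ε : ℝ => secondDeriv L x₀ v v / 2 + ε * ‖v‖ ^ 2) (𝓝[>] 0)
      (𝓝 (secondDeriv L x₀ v v / 2 + 0 * ‖v‖ ^ 2)) :=
    ((by fun_prop : Continuous fun ε : ℝ => secondDeriv L x₀ v v / 2 + ε * ‖v‖ ^ 2).tendsto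
      0).mono_left nhdsWithin_le_nhds
  have := ge_of_tendsto hl (eventually_mem_nhdsWithin.mono fun ε h => hε ε h)
  linarith

section Necessary

variable {E : Type*} [NormedAddCommGroup E] [InnerProductSpace ℝ E] [FiniteDimensional ℝ E]
  {m : ℕ} {g : E → Fin m → ℝ} {φ : E → ℝ} {x₀ : E}

theorem exists_seq_eq_zero_tangent_of_gradientRank (hg0 : g x₀ = 0)
    (hg : ∀ᶠ y in 𝓝 x₀, DifferentiableAt ℝ g y)
    (hrank : ∀ᶠ y in 𝓝 x₀, gradientRank g y = gradientRank g x₀)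
    {v : E} (hv : ∀ i, fderiv ℝ (fun z => g z i) x₀ v = 0) :
    ∃ (t : ℕ → ℝ) (w : ℕ → E), (∀ k, 0 < t k) ∧ Tendsto t atTop (𝓝 0) ∧ Tendsto w atTop (𝓝 v) ∧
      ∀ k, g (x₀ + t k • w k) = 0 := by
  refine exists_seq_eq_zero_tangent hg0 hg ?_ ?_
  · filter_upwards [hg, hrank] with y hy hyr
    rw [← gradientRank_eq_finrank_range hy, ← gradientRank_eq_finrank_range hg.self_of_nhds, hyr]
  · funext i
    have := hv i
    rwa [fderiv_pi_component hg.self_of_nhds] at this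

/-- Lagrange multipliers under a constant rank condition, for differentiable functions. -/
theorem IsLocalMinOn.exists_multipliers_of_gradientRank (hg0 : g x₀ = 0)
    (hg : ∀ᶠ y in 𝓝 x₀, DifferentiableAt ℝ g y)
    (hrank : ∀ᶠ y in 𝓝 x₀, gradientRank g y = gradientRank g x₀)
    (hφ : DifferentiableAt ℝ φ x₀) (hmin : IsLocalMinOn φ {x | g x = 0} x₀) :
    ∃ y : Fin m → ℝ, fderiv ℝ φ x₀ + ∑ i, y i • fderiv ℝ (fun z => g z i) x₀ = 0 := by
  -- Applied to v and -v, this makes Dφ(x₀) vanish on the common kernel of the gradients, hence lie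
  -- in their span.
  have hnn : ∀ v, (∀ i, fderiv ℝ (fun z => g z i) x₀ v = 0) → 0 ≤ fderiv ℝ φ x₀ v := by
    intro v hv
    obtain ⟨t, w, ht0, ht, hw, hgw⟩ := exists_seq_eq_zero_tangent_of_gradientRank hg0 hg hrank hv
    refine ge_of_tendsto (hφ.hasFDerivAt.tendsto_inv_smul_sub ht0 ht hw) ?_
    have hlim : Tendsto (fun k => x₀ + t k • w k) atTop (𝓝 x₀) := by
      simpa using (ht.smul hw).const_add x₀
    filter_upwards [hlim.eventually (eventually_nhdsWithin_iff.1 hmin)] with k hk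
    exact mul_nonneg (inv_nonneg.2 (ht0 k).le) (sub_nonneg.2 (hk (hgw k)))
  have hmem := mem_span_of_iInf_ker_le_ker
    (L := fun i => (fderiv ℝ (fun z => g z i) x₀ : E →ₗ[ℝ] ℝ)) (K := (fderiv ℝ φ x₀ : E →ₗ[ℝ] ℝ))
    (fun v hv => by
      have hv' : ∀ i, fderiv ℝ (fun z => g z i) x₀ v = 0 := fun i => (Submodule.mem_iInf _).1 hv i
      have h1 := hnn v hv'
      have h2 := hnn (-v) fun i => by rw [map_neg, hv' i, neg_zero]
      rw [map_neg] at h2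
      exact le_antisymm (neg_nonneg.1 h2) h1)
  obtain ⟨c, hc⟩ := (Submodule.mem_span_range_iff_exists_fun ℝ).1 hmem
  refine ⟨fun i => -c i, ?_⟩
  ext v
  have := LinearMap.congr_fun hc v
  simp only [LinearMap.coe_sum, Finset.sum_apply, LinearMap.smul_apply,
    ContinuousLinearMap.coe_coe] at this
  simp [← this]

/-- Second order necessary conditions under a constant rank condition. -/
theorem IsLocalMinOn.secondDeriv_nonneg_of_gradientRank (hg0 : g x₀ = 0)
    (hg : ∀ᶠ y in 𝓝 x₀, DifferentiableAt ℝ g y)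
    (hrank : ∀ᶠ y in 𝓝 x₀, gradientRank g y = gradientRank g x₀)
    (hmin : IsLocalMinOn φ {x | g x = 0} x₀)
    {L : E → ℝ} (hLφ : ∀ x, g x = 0 → L x = φ x)
    (hL : ∀ᶠ y in 𝓝 x₀, DifferentiableAt ℝ L y)
    (hL2 : DifferentiableAt ℝ (fderiv ℝ L) x₀) (hL0 : fderiv ℝ L x₀ = 0)
    {v : E} (hv : ∀ i, fderiv ℝ (fun z => g z i) x₀ v = 0) : 0 ≤ secondDeriv L x₀ v v := by
  obtain ⟨t, w, ht0, ht, hw, hgw⟩ := exists_seq_eq_zero_tangent_of_gradientRank hg0 hg hrank hv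
  refine secondDeriv_nonneg_of_tangent hL hL2 hL0 ht0 ht hw ?_
  have hlim : Tendsto (fun k => x₀ + t k • w k) atTop (𝓝 x₀) := by
    simpa using (ht.smul hw).const_add x₀
  filter_upwards [hlim.eventually (eventually_nhdsWithin_iff.1 hmin)] with k hk
  rw [hLφ _ hg0, hLφ _ (hgw k)]
  exact hk (hgw k)

end Necessary

/-! ### Logarithmically homogeneous barriers -/

theorem ConvexOn.add_fderiv_sub_le {V : Type*} [NormedAddCommGroup V] [NormedSpace ℝ V]
    {s : Set V} {h : V → ℝ} (hc : ConvexOn ℝ s h) {x y : V} (hx : x ∈ s) (hy : y ∈ s)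
    (hd : DifferentiableAt ℝ h x) : h x + fderiv ℝ h x (y - x) ≤ h y := by
  have hlim := hd.hasFDerivAt.tendsto_inv_smul_sub (t := fun k : ℕ => 1 / ((k : ℝ) + 1))
    (fun k => by positivity) tendsto_one_div_add_atTop_nhds_zero_nat
    (tendsto_const_nhds (x := y - x))
  have : fderiv ℝ h x (y - x) ≤ h y - h x := by
    refine le_of_tendsto hlim (Eventually.of_forall fun k => ?_)
    set t : ℝ := 1 / ((k : ℝ) + 1) with ht
    have ht0 : 0 < t := by positivity
    have ht1 : t ≤ 1 := by
      rw [ht, div_le_one (by positivity)]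
      linarith [(Nat.cast_nonneg k : (0 : ℝ) ≤ k)]
    have := hc.2 hx hy (sub_nonneg.2 ht1) ht0.le (by ring)
    have e : (1 - t) • x + t • y = x + t • (y - x) := by
      rw [sub_smul, one_smul, smul_sub]; abel
    rw [e, smul_eq_mul, smul_eq_mul] at this
    rw [inv_mul_le_iff₀ ht0]
    linarith
  linarith

section Barrier

variable {G : Type*} [NormedAddCommGroup G] [NormedSpace ℝ G] {K : ProperCone ℝ G}

open scoped Pointwise in
theorem ProperCone.smul_mem_interior {x : G} (hx : x ∈ interior (K : Set G)) {t : ℝ}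
    (ht : 0 < t) : t • x ∈ interior (K : Set G) := by
  have h1 : t • x ∈ t • interior (K : Set G) := Set.smul_mem_smul_set hx
  rw [← interior_smul₀ ht.ne'] at h1
  refine interior_mono ?_ h1
  rintro _ ⟨y, hy, rfl⟩
  exact K.smul_mem hy ht.le

namespace IsLogHomBarrier

variable {ν : ℝ} {h : G → ℝ}

theorem contDiffAt (hh : IsLogHomBarrier K ν h) {x : G} (hx : x ∈ interior (K : Set G)) : ContDiffAt ℝ 3 h x :=
  hh.contDiffOn.contDiffAt (isOpen_interior.mem_nhds hx)

theorem differentiableAt (hh : IsLogHomBarrier K ν h) {x : G} (hx : x ∈ interior (K : Set G)) : DifferentiableAt ℝ h x :=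
  (hh.contDiffAt hx).differentiableAt (by norm_num)

theorem differentiableAt_fderiv (hh : IsLogHomBarrier K ν h) {x : G} (hx : x ∈ interior (K : Set G)) :
    DifferentiableAt ℝ (fderiv ℝ h) x :=
  ((hh.contDiffAt hx).fderiv_right (m := 2) (by norm_num)).differentiableAt (by norm_num)

/-- Differentiation of the homogeneity identity in t at t = 1. -/
theorem fderiv_self (hh : IsLogHomBarrier K ν h) {x : G} (hx : x ∈ interior (K : Set G)) : fderiv ℝ h x x = -ν := by
  have h1 : HasDerivAt (fun t : ℝ => h (t • x)) (fderiv ℝ h x x) 1 := by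
    have hl : HasDerivAt (fun t : ℝ => t • x) x 1 := by
      simpa using (hasDerivAt_id (1 : ℝ)).smul_const x
    refine HasFDerivAt.comp_hasDerivAt (1 : ℝ) ?_ hl
    rw [one_smul]
    exact (hh.differentiableAt hx).hasFDerivAt
  have h2 : HasDerivAt (fun t : ℝ => h (t • x)) (-ν) 1 := by
    have := ((Real.hasDerivAt_log one_ne_zero).const_mul ν).const_sub (h x)
    rw [inv_one, mul_one] at this
    refine this.congr_of_eventuallyEq ?_
    filter_upwards [lt_mem_nhds one_pos] with t ht
    exact hh.log_homogeneous x hx t ht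
  exact h1.unique h2

/-- The tangent plane at x lies below h at t z, where h equals h z - ν log t. Dividing by t and
letting t → ∞ leaves only Dh(x)[z] ≤ 0. -/
theorem fderiv_nonpos_of_mem_interior (hh : IsLogHomBarrier K ν h) {x z : G}
    (hx : x ∈ interior (K : Set G)) (hz : z ∈ interior (K : Set G)) : fderiv ℝ h x z ≤ 0 := by
  set a := h z - h x + fderiv ℝ h x x with ha
  have hlim : Tendsto (fun t : ℝ => a / t - ν * (Real.log t / t)) atTop (𝓝 0) := by
    have h1 : Tendsto (fun t : ℝ => Real.log t / t) atTop (𝓝 0) :=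
      Real.isLittleO_log_id_atTop.tendsto_div_nhds_zero
    simpa using (tendsto_const_nhds.div_atTop tendsto_id : Tendsto (fun t : ℝ => a / t) atTop
      (𝓝 0)).sub (h1.const_mul ν)
  refine ge_of_tendsto hlim ?_
  filter_upwards [eventually_gt_atTop 0] with t ht
  have h1 := hh.convexOn.add_fderiv_sub_le hx (ProperCone.smul_mem_interior hz ht)
    (hh.differentiableAt hx)
  rw [hh.log_homogeneous z hz t ht, map_sub, map_smul, smul_eq_mul] at h1
  rw [← mul_div_assoc, ← sub_div, le_div_iff₀ ht]
  linarith

theorem neg_fderiv_mem_dualCone (hh : IsLogHomBarrier K ν h) {x : G} (hx : x ∈ interior (K : Set G)) :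
    -fderiv ℝ h x ∈ dualCone K := by
  intro z hz
  have hcl : z ∈ closure (interior (K : Set G)) := by
    rw [K.convex.closure_interior_eq_closure_of_nonempty_interior ⟨x, hx⟩]
    exact subset_closure hz
  have hcd : IsClosed {z : G | 0 ≤ (-fderiv ℝ h x) z} :=
    isClosed_le continuous_const (-fderiv ℝ h x).continuous
  refine hcd.closure_subset_iff.2 (fun w hw => ?_) hcl
  exact neg_nonneg.2 (hh.fderiv_nonpos_of_mem_interior hx hw)

/-- A supporting affine function of the convex h is bounded below on bounded sets. -/
theorem exists_lower_bound (hh : IsLogHomBarrier K ν h)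
    (hK : (interior (K : Set G)).Nonempty) (B : ℝ) :
    ∃ M, ∀ z ∈ interior (K : Set G), ‖z‖ ≤ B → M ≤ h z := by
  obtain ⟨x, hx⟩ := hK
  refine ⟨h x - ‖fderiv ℝ h x‖ * (B + ‖x‖), fun z hz hzB => ?_⟩
  have h1 := hh.convexOn.add_fderiv_sub_le hx hz (hh.differentiableAt hx)
  have h2 := (abs_le.1 ((fderiv ℝ h x).le_opNorm (z - x))).1
  have h3 : ‖fderiv ℝ h x‖ * ‖z - x‖ ≤ ‖fderiv ℝ h x‖ * (B + ‖x‖) :=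
    mul_le_mul_of_nonneg_left ((norm_sub_le z x).trans (by linarith)) (norm_nonneg _)
  linarith

end IsLogHomBarrier

/-! ### The proximal barrier subproblem -/

variable {E : Type*} [NormedAddCommGroup E] [InnerProductSpace ℝ E] [FiniteDimensional ℝ E]

/-- The barrier subproblem with a quadratic proximal term attains its minimum near a local
solution. -/
theorem IsLogHomBarrier.exists_isLocalMinOn {m : ℕ} {ν : ℝ} {h : G → ℝ}
    (hh : IsLogHomBarrier K ν h) (hK : (interior (K : Set G)).Nonempty)
    {f : E → ℝ} {g : E → Fin m → ℝ} {c : E → G}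
    (hf_cont : ContinuousOn f (conicSet K c)) (hc_cont : ContinuousOn c (conicSet K c))
    (hclosed : IsClosed (feasibleSet K g c))
    (hc_diff : ∀ x ∈ strictConicSet K c, DifferentiableAt ℝ c x)
    {xstar : E} (hxstar : IsLocalSolution K f g c xstar)
    (happrox : ∃ z : ℕ → E, (∀ k, z k ∈ strictlyFeasibleSet K g c) ∧
      Tendsto z atTop (𝓝 xstar)) {ε : ℝ} (hε : 0 < ε) :
    ∃ (θ : ℝ) (x : E), 0 < θ ∧ θ < ε ∧ ‖x - xstar‖ < ε ∧ x ∈ strictlyFeasibleSet K g c ∧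
      IsLocalMinOn (fun x => f x + θ * h (c x) + ε * ‖x - xstar‖ ^ 2) {x | g x = 0} x := by
  obtain ⟨hxf, hxmin⟩ := hxstar
  obtain ⟨δ, hδ0, hδ⟩ := Metric.nhds_basis_closedBall.eventually_iff.1
    (eventually_nhdsWithin_iff.1 hxmin)
  set R := min δ ε with hR
  have hR0 : 0 < R := lt_min hδ0 hε
  set S := Metric.closedBall xstar R ∩ feasibleSet K g c with hS
  have hScomp : IsCompact S := (isCompact_closedBall xstar R).inter_right hclosed
  have hSC : S ⊆ conicSet K c := fun x hx => hx.2.2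
  have hSmin : ∀ x ∈ S, f xstar ≤ f x := fun x hx =>
    hδ (Metric.closedBall_subset_closedBall (min_le_left _ _) hx.1) hx.2
  have hcS := hc_cont.mono hSC
  have hfS := hf_cont.mono hSC
  have hsub : strictlyFeasibleSet K g c ⊆ feasibleSet K g c := fun x hx =>
    ⟨hx.1, interior_subset hx.2⟩
  obtain ⟨M, hM⟩ : ∃ M, ∀ x ∈ S, c x ∈ interior (K : Set G) → M ≤ h (c x) := by
    obtain ⟨B, hB⟩ := (hScomp.image_of_continuousOn hcS).isBounded.exists_norm_le
    obtain ⟨M, hM⟩ := hh.exists_lower_bound hK B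
    exact ⟨M, fun x hx hcx => hM _ hcx (hB _ ⟨x, hx, rfl⟩)⟩
  obtain ⟨z, hzs, hzR, hzf⟩ : ∃ z ∈ strictlyFeasibleSet K g c, z ∈ Metric.closedBall xstar R ∧
      f z - f xstar + ε * ‖z - xstar‖ ^ 2 < ε * R ^ 2 / 2 := by
    obtain ⟨z, hz, hzlim⟩ := happrox
    have hzC : ∀ k, z k ∈ conicSet K c := fun k => (hsub (hz k)).2
    have hfz : Tendsto (fun k => f (z k)) atTop (𝓝 (f xstar)) :=
      (hf_cont xstar hxf.2).tendsto.comp (tendsto_nhdsWithin_iff.2 ⟨hzlim, .of_forall hzC⟩)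
    have hlim : Tendsto (fun k => f (z k) - f xstar + ε * ‖z k - xstar‖ ^ 2) atTop (𝓝 0) := by
      simpa using (hfz.sub_const (f xstar)).add
        (((hzlim.sub_const xstar).norm.pow 2).const_mul ε)
    obtain ⟨k, hk1, hk2⟩ := ((hlim.eventually_lt_const (by positivity : 0 < ε * R ^ 2 / 2)).and
      (hzlim.eventually (Metric.closedBall_mem_nhds xstar hR0))).exists
    exact ⟨z k, hz k, hk2, hk1⟩
  have hzS : z ∈ S := ⟨hzR, hsub hzs⟩
  have hDM : 0 ≤ h (c z) - M := sub_nonneg.2 (hM z hzS hzs.2)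
  -- Half of the budget ε R² pays for the gap of the reference point z, the other half for the
  -- barrier term.
  obtain ⟨θ, hθ0, hθε, hθ⟩ : ∃ θ > 0, θ < ε ∧ θ * (h (c z) - M) < ε * R ^ 2 / 2 := by
    have hlim : Tendsto (fun θ : ℝ => θ * (h (c z) - M)) (𝓝[>] 0) (𝓝 (0 * (h (c z) - M))) :=
      ((continuous_mul_const _).tendsto 0).mono_left nhdsWithin_le_nhds
    rw [zero_mul] at hlim
    obtain ⟨θ, h1, h2⟩ := ((hlim.eventually_lt_const (by positivity : 0 < ε * R ^ 2 / 2)).and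
      (Ioo_mem_nhdsGT hε)).exists
    exact ⟨θ, h2.1, h2.2, h1⟩
  set ψ : E → ℝ := fun x => f x + θ * h (c x) + ε * ‖x - xstar‖ ^ 2 with hψ
  -- The sublevel set of ψ written as a preimage of the epigraph of h, so that closedness of h makes
  -- it closed even though c may reach the boundary of K.
  set A := S ∩ (fun x => (c x, (ψ z - f x - ε * ‖x - xstar‖ ^ 2) / θ)) ⁻¹'
    {p : G × ℝ | p.1 ∈ interior (K : Set G) ∧ h p.1 ≤ p.2} with hA
  have hAiff : ∀ x, x ∈ A ↔ x ∈ S ∧ c x ∈ interior (K : Set G) ∧ ψ x ≤ ψ z := fun x => by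
    simp only [hA, Set.mem_inter_iff, Set.mem_preimage, Set.mem_ofPred_eq, le_div_iff₀ hθ0]
    refine and_congr_right fun _ => and_congr_right fun _ => ?_
    simp only [hψ]
    constructor <;> intro h <;> linarith
  have hAclosed : IsClosed A := by
    refine ContinuousOn.preimage_isClosed_of_isClosed ?_ hScomp.isClosed hh.closed
    refine hcS.prodMk (ContinuousOn.div_const ?_ θ)
    exact (continuousOn_const.sub hfS).sub (Continuous.continuousOn (by fun_prop))
  have hAcomp : IsCompact A := hScomp.of_isClosed_subset hAclosed Set.inter_subset_left
  have hψA : ContinuousOn ψ A := by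
    have h1 : ContinuousOn (fun x => h (c x)) A :=
      hh.contDiffOn.continuousOn.comp (hcS.mono Set.inter_subset_left)
        fun x hx => ((hAiff x).1 hx).2.1
    exact ((hfS.mono Set.inter_subset_left).add (continuousOn_const.mul h1)).add
      (Continuous.continuousOn (by fun_prop))
  obtain ⟨x, hxA, hxmin⟩ := hAcomp.exists_isMinOn ⟨z, (hAiff z).2 ⟨hzS, hzs.2, le_rfl⟩⟩ hψA
  obtain ⟨hxS, hxint, hxz⟩ := (hAiff x).1 hxA
  have hmin : ∀ y ∈ S, c y ∈ interior (K : Set G) → ψ x ≤ ψ y := fun y hy hcy => by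
    rcases le_total (ψ y) (ψ z) with hyz | hyz
    · exact hxmin ((hAiff y).2 ⟨hy, hcy, hyz⟩)
    · exact hxz.trans hyz
  -- Comparing ψ x ≤ ψ z with f xstar ≤ f x and M ≤ h (c x) gives ε‖x - xstar‖² < ε R².
  have hxR : ‖x - xstar‖ < R := by
    have h1 := hSmin x hxS
    have h2 := hM x hxS hxint
    have h3 : θ * M ≤ θ * h (c x) := mul_le_mul_of_nonneg_left h2 hθ0.le
    have h4 : ε * ‖x - xstar‖ ^ 2 < ε * R ^ 2 := by
      simp only [hψ] at hxz
      linarith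
    exact lt_of_pow_lt_pow_left₀ 2 hR0.le (lt_of_mul_lt_mul_left h4 hε.le)
  refine ⟨θ, x, hθ0, hθε, hxR.trans_le (min_le_right _ _), ⟨hxS.2.1, hxint⟩, ?_⟩
  refine eventually_nhdsWithin_iff.2 ?_
  -- The ball and conic constraints are both inactive near x, so minimality holds relative to g = 0
  -- alone.
  have hball : ∀ᶠ y in 𝓝 x, y ∈ Metric.ball xstar R :=
    Metric.isOpen_ball.mem_nhds (mem_ball_iff_norm.2 hxR)
  filter_upwards [hball, (hc_diff x hxint).continuousAt.eventually
    (isOpen_interior.mem_nhds hxint)] with y hyR hcy hgy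
  exact hmin y ⟨Metric.ball_subset_closedBall hyR, hgy, interior_subset hcy⟩ hcy

end Barrier

/-! ### Derivatives of the penalised objective and its Lagrangian -/

section Penalized

variable {E G : Type*} [NormedAddCommGroup E] [InnerProductSpace ℝ E]
  [NormedAddCommGroup G] [NormedSpace ℝ G] {m : ℕ}
  {f : E → ℝ} {g : E → Fin m → ℝ} {c : E → G} {h : G → ℝ} {x : E}

theorem hasFDerivAt_barrier_prox (hf : DifferentiableAt ℝ f x) (hc : DifferentiableAt ℝ c x)
    (hh : DifferentiableAt ℝ h (c x)) (θ ε : ℝ) (a : E) :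
    HasFDerivAt (fun z => f z + θ * h (c z) + ε * ‖z - a‖ ^ 2)
      (fderiv ℝ f x + θ • (fderiv ℝ h (c x)).comp (fderiv ℝ c x)
        + (2 * ε) • innerSL ℝ (x - a)) x := by
  have h1 : HasFDerivAt (fun z => ‖z - a‖ ^ 2) (2 • innerSL ℝ (x - a)) x := by
    have := (hasStrictFDerivAt_norm_sq (x - a)).hasFDerivAt.comp x
      ((hasFDerivAt_id x).sub_const a)
    simpa [Function.comp_def] using this
  have h2 := (hf.hasFDerivAt.add ((hh.hasFDerivAt.comp x hc.hasFDerivAt).const_mul θ)).add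
    (h1.const_mul ε)
  refine h2.congr_fderiv ?_
  ext d
  simp
  ring

theorem TwiceDifferentiableAtPoints.differentiableAt_fderiv_component {U : Set E}
    (hg : TwiceDifferentiableAtPoints g U) (hU : U ∈ 𝓝 x) (i : Fin m) :
    DifferentiableAt ℝ (fderiv ℝ fun z => g z i) x := by
  have h1 : DifferentiableAt ℝ
      (fun z => (ContinuousLinearMap.proj i : (Fin m → ℝ) →L[ℝ] ℝ).comp (fderiv ℝ g z)) x :=
    (differentiableAt_const _).clm_comp (hg x (mem_of_mem_nhds hU)).2
  refine h1.congr_of_eventuallyEq ?_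
  filter_upwards [hU] with z hz
  exact fderiv_pi_component (hg z hz).1 i

/-- Differentiating θ h∘c twice gives a curvature term θ D²h[Dc d, Dc d] and a term θ Dh[D²c[d,d]];
the latter is the conic part of the Lagrangian Hessian for s = -θ Dh(c(x)). -/
theorem secondDeriv_penalized_lagrangian {U : Set E} (hU : U ∈ 𝓝 x)
    (hf : TwiceDifferentiableAtPoints f U) (hg : TwiceDifferentiableAtPoints g U)
    (hc : TwiceDifferentiableAtPoints c U) (hh : ∀ z ∈ U, DifferentiableAt ℝ h (c z))
    (hh2 : DifferentiableAt ℝ (fderiv ℝ h) (c x)) (θ ε : ℝ) (a : E) (y : Fin m → ℝ) :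
    (∀ᶠ z in 𝓝 x, DifferentiableAt ℝ
      (fun z => f z + θ * h (c z) + ε * ‖z - a‖ ^ 2 + ∑ i, y i * g z i) z) ∧
    fderiv ℝ (fun z => f z + θ * h (c z) + ε * ‖z - a‖ ^ 2 + ∑ i, y i * g z i) x =
      fderiv ℝ (fun z => f z + θ * h (c z) + ε * ‖z - a‖ ^ 2) x +
        ∑ i, y i • fderiv ℝ (fun z => g z i) x ∧
    DifferentiableAt ℝ
      (fderiv ℝ fun z => f z + θ * h (c z) + ε * ‖z - a‖ ^ 2 + ∑ i, y i * g z i) x ∧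
    ∀ d, secondDeriv (fun z => f z + θ * h (c z) + ε * ‖z - a‖ ^ 2 + ∑ i, y i * g z i) x d d =
      lagrangianHessian f g c x y (-(θ • fderiv ℝ h (c x))) d
        + θ * secondDeriv h (c x) (fderiv ℝ c x d) (fderiv ℝ c x d) + 2 * ε * inner ℝ d d := by
  have hxU := mem_of_mem_nhds hU
  set L : E → ℝ := fun z => f z + θ * h (c z) + ε * ‖z - a‖ ^ 2 + ∑ i, y i * g z i with hL
  have hLd : ∀ z ∈ U, HasFDerivAt L (fderiv ℝ f z + θ • (fderiv ℝ h (c z)).comp (fderiv ℝ c z)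
      + (2 * ε) • innerSL ℝ (z - a) + ∑ i, y i • fderiv ℝ (fun z => g z i) z) z := fun z hz => by
    refine (hasFDerivAt_barrier_prox (hf z hz).1 (hc z hz).1 (hh z hz) θ ε a).add ?_
    refine HasFDerivAt.fun_sum fun i _ => ?_
    exact (differentiableAt_pi.1 (hg z hz).1 i).hasFDerivAt.const_mul (y i)
  have hLeq : fderiv ℝ L =ᶠ[𝓝 x] fun z =>
      fderiv ℝ f z + θ • (fderiv ℝ h (c z)).comp (fderiv ℝ c z)
      + (2 * ε) • innerSL ℝ (z - a) + ∑ i, y i • fderiv ℝ (fun z => g z i) z := by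
    filter_upwards [hU] with z hz
    exact (hLd z hz).fderiv
  have hhc : HasFDerivAt (fun z => fderiv ℝ h (c z))
      ((fderiv ℝ (fderiv ℝ h) (c x)).comp (fderiv ℝ c x)) x :=
    hh2.hasFDerivAt.comp x (hc x hxU).1.hasFDerivAt
  obtain ⟨I, hI, hin⟩ : ∃ I : E →L[ℝ] StrongDual ℝ E, (∀ d, I d d = inner ℝ d d) ∧
      HasFDerivAt (fun z : E => innerSL ℝ (z - a)) I x :=
    ⟨innerSL ℝ, fun _ => rfl,
      ((innerSL ℝ).hasFDerivAt.comp x ((hasFDerivAt_id x).sub_const a)).congr_fderiv (by ext; rfl)⟩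
  have hD2 := (((hf x hxU).2.hasFDerivAt.add
    ((hhc.clm_comp (hc x hxU).2.hasFDerivAt).const_smul θ)).add (hin.const_smul (2 * ε))).add
    (HasFDerivAt.fun_sum (u := Finset.univ) fun i _ =>
      (hg.differentiableAt_fderiv_component hU i).hasFDerivAt.const_smul (y i))
  have hL2 := HasFDerivAt.congr_of_eventuallyEq hD2 hLeq
  refine ⟨?_, ?_, hL2.differentiableAt, fun d => ?_⟩
  · filter_upwards [hU] with z hz
    exact (hLd z hz).differentiableAt
  · rw [(hLd x hxU).fderiv, (hasFDerivAt_barrier_prox (hf x hxU).1 (hc x hxU).1 (hh x hxU)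
      θ ε a).fderiv]
  · rw [secondDeriv, hL2.fderiv]
    simp [lagrangianHessian, secondDeriv, hI]
    ring

end Penalized

/-! ### Approximate KKT points and passage to sequences -/

/-- An approximate KKT point of first and second order within distance `ε` of a local solution. -/
theorem exists_approximate_kkt_point
    {E G : Type*} [NormedAddCommGroup E] [InnerProductSpace ℝ E] [FiniteDimensional ℝ E]
    [NormedAddCommGroup G] [NormedSpace ℝ G] {m : ℕ}
    {K : ProperCone ℝ G} (hK : (interior (K : Set G)).Nonempty)
    {ν : ℝ} {h : G → ℝ} (hh : IsLogHomBarrier K ν h)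
    {f : E → ℝ} {g : E → Fin m → ℝ} {c : E → G}
    (hf_cont : ContinuousOn f (conicSet K c))
    (hc_cont : ContinuousOn c (conicSet K c))
    (hclosed : IsClosed (feasibleSet K g c))
    (hf_diff : ∀ x ∈ strictConicSet K c, DifferentiableAt ℝ f x)
    (hg_diff : ∀ x ∈ strictConicSet K c, DifferentiableAt ℝ g x)
    (hc_diff : ∀ x ∈ strictConicSet K c, DifferentiableAt ℝ c x)
    (hrank : ConstantRankCQ K g c)
    {xstar : E} (hxstar : IsLocalSolution K f g c xstar)
    (happrox : ∃ z : ℕ → E, (∀ k, z k ∈ strictlyFeasibleSet K g c) ∧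
      Tendsto z atTop (𝓝 xstar)) {ε : ℝ} (hε : 0 < ε) :
    ∃ (θ : ℝ) (x : E) (y : Fin m → ℝ) (s : StrongDual ℝ G), 0 < θ ∧ θ < ε ∧
      ‖x - xstar‖ < ε ∧ s ∈ dualCone K ∧ (c x ∈ interior (K : Set G) ∧ g x = 0) ∧
      ‖lagrangianGradient f g c x y s‖ ≤ 2 * ε * ε ∧ s (c x) = θ * ν ∧
      (TwiceDifferentiableAtPoints f (strictConicSet K c) →
        TwiceDifferentiableAtPoints g (strictConicSet K c) →
        TwiceDifferentiableAtPoints c (strictConicSet K c) →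
        ∀ d : E, (∀ i, fderiv ℝ (fun z => g z i) x d = 0) →
          0 ≤ lagrangianHessian f g c x y s d
            + θ * secondDeriv h (c x) (fderiv ℝ c x d) (fderiv ℝ c x d)
            + 2 * ε * inner ℝ d d) := by
  obtain ⟨θ, x, hθ0, hθε, hxε, ⟨hgx, hcx⟩, hmin⟩ :=
    hh.exists_isLocalMinOn hK hf_cont hc_cont hclosed hc_diff hxstar happrox hε
  have hU : strictConicSet K c ∈ 𝓝 x :=
    (hc_diff x hcx).continuousAt (isOpen_interior.mem_nhds hcx)
  have hgd : ∀ᶠ z in 𝓝 x, DifferentiableAt ℝ g z := by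
    filter_upwards [hU] with z hz using hg_diff z hz
  have hφ := hasFDerivAt_barrier_prox (hf_diff x hcx) (hc_diff x hcx) (hh.differentiableAt hcx)
    θ ε xstar
  obtain ⟨y, hy⟩ := hmin.exists_multipliers_of_gradientRank hgx hgd (hrank x ⟨hgx, hcx⟩)
    hφ.differentiableAt
  refine ⟨θ, x, y, -(θ • fderiv ℝ h (c x)), hθ0, hθε, hxε, fun z hz => ?_, ⟨hcx, hgx⟩, ?_, ?_,
    fun hf2 hg2 hc2 d hd => ?_⟩
  · have := hh.neg_fderiv_mem_dualCone hcx z hz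
    rw [← smul_neg]
    exact mul_nonneg hθ0.le this
  -- Stationarity of the subproblem leaves exactly the gradient of the proximal term, of norm 2ε‖x -
  -- xstar‖.
  · have e : lagrangianGradient f g c x y (-(θ • fderiv ℝ h (c x))) =
        -((2 * ε) • innerSL ℝ (x - xstar)) := by
      rw [eq_neg_iff_add_eq_zero, ← hy, hφ.fderiv, lagrangianGradient,
        ContinuousLinearMap.neg_comp, ContinuousLinearMap.smul_comp]
      abel
    rw [e, norm_neg, norm_smul, innerSL_apply_norm, Real.norm_of_nonneg (by positivity)]
    exact mul_le_mul_of_nonneg_left hxε.le (by positivity)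
  · simp [hh.fderiv_self hcx]
  · obtain ⟨h1, h2, h3, h4⟩ := secondDeriv_penalized_lagrangian hU hf2 hg2 hc2
      (fun z hz => hh.differentiableAt hz) (hh.differentiableAt_fderiv hcx) θ ε xstar y
    rw [← h4 d]
    -- The added terms y i * g z i vanish on the fibre, so the Lagrangian agrees there with the
    -- penalised objective.
    refine hmin.secondDeriv_nonneg_of_gradientRank hgx hgd (hrank x ⟨hgx, hcx⟩)
      (fun z hz => ?_) h1 h3 (h2.trans hy) hd
    simp [hz]

theorem mainTheorem3
    {E G : Type*} [NormedAddCommGroup E] [InnerProductSpace ℝ E] [FiniteDimensional ℝ E]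
    [NormedAddCommGroup G] [NormedSpace ℝ G] [FiniteDimensional ℝ G] {m : ℕ}
    (K : ProperCone ℝ G) (hK : IsRegularCone K)
    (ν : ℝ) (h : G → ℝ) (hh : IsLogHomBarrier K ν h)
    (f : E → ℝ) (g : E → Fin m → ℝ) (c : E → G)
    (hf_cont : ContinuousOn f (conicSet K c))
    (hg_cont : ContinuousOn g (conicSet K c))
    (hc_cont : ContinuousOn c (conicSet K c))
    (hclosed : IsClosed (feasibleSet K g c))
    (hf_diff : ∀ x ∈ strictConicSet K c, DifferentiableAt ℝ f x)
    (hg_diff : ∀ x ∈ strictConicSet K c, DifferentiableAt ℝ g x)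
    (hc_diff : ∀ x ∈ strictConicSet K c, DifferentiableAt ℝ c x)
    (hrank : ConstantRankCQ K g c)
    (xstar : E) (hxstar : IsLocalSolution K f g c xstar)
    (happrox : ∃ z : ℕ → E, (∀ k, z k ∈ strictlyFeasibleSet K g c) ∧
      Tendsto z atTop (𝓝 xstar)) :
    ∃ (x : ℕ → E) (y : ℕ → Fin m → ℝ) (s : ℕ → StrongDual ℝ G),
      (∀ k, s k ∈ dualCone K) ∧
      (∀ k, c (x k) ∈ interior (K : Set G) ∧ g (x k) = 0) ∧
      Tendsto x atTop (𝓝 xstar) ∧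
      Tendsto (fun k => lagrangianGradient f g c (x k) (y k) (s k)) atTop (𝓝 0) ∧
      Tendsto (fun k => s k (c (x k))) atTop (𝓝 0) ∧
      (TwiceDifferentiableAtPoints f (strictConicSet K c) →
        TwiceDifferentiableAtPoints g (strictConicSet K c) →
        TwiceDifferentiableAtPoints c (strictConicSet K c) →
        ∃ θ δ : ℕ → ℝ, (∀ k, 0 < θ k) ∧ (∀ k, 0 < δ k) ∧
          Tendsto θ atTop (𝓝 0) ∧ Tendsto δ atTop (𝓝 0) ∧
          ∀ k, ∀ d : E, (∀ i, fderiv ℝ (fun z => g z i) (x k) d = 0) →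
            0 ≤ lagrangianHessian f g c (x k) (y k) (s k) d
              + θ k * secondDeriv h (c (x k)) (fderiv ℝ c (x k) d) (fderiv ℝ c (x k) d)
              + δ k * inner ℝ d d) := by
  have hk0 : ∀ k : ℕ, (0 : ℝ) < 1 / ((k : ℝ) + 1) := fun k => by positivity
  have hlim : Tendsto (fun k : ℕ => 1 / ((k : ℝ) + 1)) atTop (𝓝 0) :=
    tendsto_one_div_add_atTop_nhds_zero_nat
  -- The choice precedes any second-order assumption, so the same sequences serve both conclusions.
  choose θ x y s hθ0 hθ hx hs hfeas hgrad hcompl hsecond using fun k : ℕ =>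
    exists_approximate_kkt_point hK.solid hh hf_cont hc_cont hclosed hf_diff hg_diff hc_diff hrank
      hxstar happrox (hk0 k)
  have hθlim : Tendsto θ atTop (𝓝 0) :=
    squeeze_zero (fun k => (hθ0 k).le) (fun k => (hθ k).le) hlim
  refine ⟨x, y, s, hs, hfeas, ?_, ?_, ?_, fun hf2 hg2 hc2 =>
    ⟨θ, fun k => 2 * (1 / ((k : ℝ) + 1)), hθ0, fun k => by positivity, hθlim, ?_,
      fun k => hsecond k hf2 hg2 hc2⟩⟩
  · rw [tendsto_iff_norm_sub_tendsto_zero]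
    exact squeeze_zero (fun k => norm_nonneg _) (fun k => (hx k).le) hlim
  · rw [tendsto_zero_iff_norm_tendsto_zero]
    exact squeeze_zero (fun k => norm_nonneg _) hgrad (by simpa using (hlim.const_mul 2).mul hlim)
  · simpa [hcompl] using hθlim.mul_const ν
  · simpa using hlim.const_mul 2
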